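/- Let $X,Y$ be finite non-empty sets and $f:X\times Y\to Z$. Al holds $x\in X$ and Bob holds $y\in Y$. *Protocols.* In a classical (randomized) protocol the players have independent private coins and exchange bits, each bit being determined by the sender's input, his coins, and the bits sent so far; the protocol is deterministic if no coins are used. In a quantum protocol each player starts with finitely many private qubits in state $|0\rangle$; in each round one player applies a unitary transformation, which may depend on his (classical, never erased) input, to the qubits he owns and then sends some of them to the other player, the schedule and the choice of qubits not depending on the inputs. At the end both players declare an output, computed from what they hold (in the quantum case after measuring their qubits). A protocol computes $h:X\times Y\to W$ with error $\varepsilon$ if on every input, with probability at least $1-\varepsilon$, both outputs equal $h(x,y)$. *Privacy.* For a distribution $\mu$ on $X\times Y$ and a time $t$ of the protocol let $A$, $B$ be what Al and Bob hold at that time besides their inputs (coins and all bits exchanged so far in the classical case, the qubits currently owned in the quantum case). The privacy loss of the protocol for $h$ is the supremum, over all $t$ and all $\mu$, of the conditional mutual informations $I(B:X\mid Y,h(X,Y))$ and $I(A:Y\mid X,h(X,Y))$ (Shannon entropy in the classical case, von Neumann entropy in the quantum case). A function $h$ is privately computable by deterministic protocols if some deterministic protocol computes it without error and has privacy loss $0$;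 it is privately computable with error $\varepsilon$ by classical (respectively quantum) protocols if some classical randomized (respectively quantum) protocol computes it with error $\varepsilon$ and has privacy loss exactly $0$. *Hint sense.* With respect to one of these three kinds of protocols, $f$ can be computed with privacy loss $k$ in the hint sense if there are a finite set $W$ and a privately computable $h:X\times Y\to W$ such that $f(x,y)$ is determined by $h(x,y)$, i.e. $f=g\circ h$ for some $g:W\to Z$, and $k=\log_2|\mathrm{range}(h)|-\log_2|\mathrm{range}(f)|$. The privacy loss of $f$ in the hint sense is the infimum of all such $k$. **Corollary.** Let $0\le\varepsilon_1,\varepsilon_2<1/2$. For every real $k$, the following are equivalent: $f$ can be computed with privacy loss $k$ in the hint sense by deterministic protocols; by classical randomized protocols with error $\varepsilon_1$; by quantum protocols with error $\varepsilon_2$. In particular the privacy loss of $f$ in the hint sense is one and the same real number for deterministic, classical randomized and quantum protocols. -/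

import Mathlib

open scoped Matrix BigOperators

noncomputable section

namespace TwoParty

universe u v w

/-! ## Entropy and conditional mutual information -/

section Information

/-- Shannon entropy (in bits) of the random variable `g` on the finite probability space `Ω` with
weights `p`. -/
def shannonEntropy {Ω S : Type*} [Fintype Ω] [DecidableEq S] (p : Ω → ℝ) (g : Ω → S) : ℝ :=
  ∑ s ∈ Finset.univ.image g, Real.negMulLog (∑ ω with g ω = s, p ω) / Real.log 2

/-- Conditional mutual information `I(V : U | Z)` of random variables on a finite space. -/
def condMutualInfo {Ω P Q R : Type*} [Fintype Ω] [DecidableEq P] [DecidableEq Q] [DecidableEq R]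
    (p : Ω → ℝ) (V : Ω → P) (U : Ω → Q) (Z : Ω → R) : ℝ :=
  shannonEntropy p (fun ω => (V ω, Z ω)) + shannonEntropy p (fun ω => (U ω, Z ω))
    - shannonEntropy p Z - shannonEntropy p (fun ω => (V ω, U ω, Z ω))

/-- Von Neumann entropy (in bits): `- ∑ λ log λ` over the multiset of all eigenvalues. -/
def vonNeumannEntropy {S : Type*} [Fintype S] [DecidableEq S] (ρ : Matrix S S ℂ) : ℝ :=
  (ρ.charpoly.roots.map fun l => Real.negMulLog l.re / Real.log 2).sum

/-- Partial trace over the first tensor factor. -/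
def traceFst {S T : Type*} [Fintype S] (ρ : Matrix (S × T) (S × T) ℂ) : Matrix T T ℂ :=
  fun i j => ∑ s, ρ (s, i) (s, j)

/-- Partial trace over the middle one of three tensor factors. -/
def traceMid {P Q R : Type*} [Fintype Q] (ρ : Matrix (P × Q × R) (P × Q × R) ℂ) :
    Matrix (P × R) (P × R) ℂ :=
  fun i j => ∑ q, ρ (i.1, q, i.2) (j.1, q, j.2)

/-- Quantum conditional mutual information `I(P : Q | R) = S(PR) + S(QR) - S(R) - S(PQR)` of a
state of three registers. -/
def qCondMutualInfo {P Q R : Type*} [Fintype P] [Fintype Q] [Fintype R]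
    [DecidableEq P] [DecidableEq Q] [DecidableEq R]
    (ρ : Matrix (P × Q × R) (P × Q × R) ℂ) : ℝ :=
  vonNeumannEntropy (traceMid ρ) + vonNeumannEntropy (traceFst ρ)
    - vonNeumannEntropy (traceFst (traceFst ρ)) - vonNeumannEntropy ρ

end Information

/-! ## Classical randomized protocols -/

section Classical

/-- A protocol tree. Al (input in `X`, private coin outcome in `RA`) and Bob (input in `Y`, private
coin outcome in `RB`) exchange bits. Whose turn it is, and how the bit to be sent is computed, is
determined by the bits sent so far, i.e. by the position in the tree. At a leaf each of the players
declares an output. -/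
inductive ProtocolTree (X : Type u) (Y : Type v) (W : Type w) (RA RB : Type) :
    Type (max u v w) where
  | output (outA : X → RA → W) (outB : Y → RB → W)
  | al (bit : X → RA → Bool) (next : Bool → ProtocolTree X Y W RA RB)
  | bob (bit : Y → RB → Bool) (next : Bool → ProtocolTree X Y W RA RB)

variable {X : Type u} {Y : Type v} {W : Type w}

/-- The sequence of bits sent when the protocol runs on the given inputs and coins. -/
def ProtocolTree.transcript {RA RB : Type} (x : X) (y : Y) (ra : RA) (rb : RB) :
    ProtocolTree X Y W RA RB → List Bool
  | .output _ _ => []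
  | .al bit next => bit x ra :: (next (bit x ra)).transcript x y ra rb
  | .bob bit next => bit y rb :: (next (bit y rb)).transcript x y ra rb

/-- The outputs of Al and of Bob. -/
def ProtocolTree.outputs {RA RB : Type} (x : X) (y : Y) (ra : RA) (rb : RB) :
    ProtocolTree X Y W RA RB → W × W
  | .output outA outB => (outA x ra, outB y rb)
  | .al bit next => (next (bit x ra)).outputs x y ra rb
  | .bob bit next => (next (bit y rb)).outputs x y ra rb

/-- A classical randomized protocol with private coins: the coin outcomes of Al and Bob are drawn
independently from the distributions `pA` and `pB`. -/
structure ClassicalProtocol (X : Type u) (Y : Type v) (W : Type w) where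
  rA : ℕ
  rB : ℕ
  pA : stdSimplex ℝ (Fin rA)
  pB : stdSimplex ℝ (Fin rB)
  tree : ProtocolTree X Y W (Fin rA) (Fin rB)

/-- A deterministic protocol is one in which the coins have a single outcome. -/
def ClassicalProtocol.IsDeterministic (P : ClassicalProtocol X Y W) : Prop :=
  P.rA = 1 ∧ P.rB = 1

variable [DecidableEq W]

/-- The protocol computes `h` with error `ε`: on every input, both players output the right value
with probability at least `1 - ε`. -/
def ClassicalProtocol.Computes (P : ClassicalProtocol X Y W) (ε : ℝ) (h : X → Y → W) : Prop :=
  ∀ x y, 1 - ε ≤ ∑ ra, ∑ rb,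
    if P.tree.outputs x y ra rb = (h x y, h x y) then P.pA.1 ra * P.pB.1 rb else 0

variable [Fintype X] [Fintype Y] [DecidableEq X] [DecidableEq Y]

/-- The joint distribution of inputs and coins when the inputs are drawn from `μ`. -/
def ClassicalProtocol.joint (P : ClassicalProtocol X Y W) (μ : stdSimplex ℝ (X × Y)) :
    X × Y × Fin P.rA × Fin P.rB → ℝ :=
  fun ω => μ.1 (ω.1, ω.2.1) * P.pA.1 ω.2.2.1 * P.pB.1 ω.2.2.2

/-- `I(B : X | Y, h(X,Y))` after `t` bits of communication, where `B` consists of Bob's coins and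
of the bits exchanged so far. -/
def ClassicalProtocol.divulgedToBob (P : ClassicalProtocol X Y W) (h : X → Y → W) (t : ℕ)
    (μ : stdSimplex ℝ (X × Y)) : ℝ :=
  condMutualInfo (P.joint μ)
    (fun ω => (ω.2.2.2, (P.tree.transcript ω.1 ω.2.1 ω.2.2.1 ω.2.2.2).take t))
    (fun ω => ω.1) (fun ω => (ω.2.1, h ω.1 ω.2.1))

/-- `I(A : Y | X, h(X,Y))` after `t` bits of communication, where `A` consists of Al's coins and
of the bits exchanged so far. -/
def ClassicalProtocol.divulgedToAl (P : ClassicalProtocol X Y W) (h : X → Y → W) (t : ℕ)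
    (μ : stdSimplex ℝ (X × Y)) : ℝ :=
  condMutualInfo (P.joint μ)
    (fun ω => (ω.2.2.1, (P.tree.transcript ω.1 ω.2.1 ω.2.2.1 ω.2.2.2).take t))
    (fun ω => ω.2.1) (fun ω => (ω.1, h ω.1 ω.2.1))

/-- The privacy loss of a classical protocol for `h`: the supremum of the divulged information over
all times, both players, and all distributions on the inputs. -/
def ClassicalProtocol.privacyLoss (P : ClassicalProtocol X Y W) (h : X → Y → W) : EReal :=
  ⨆ (t : ℕ) (μ : stdSimplex ℝ (X × Y)),
    max (P.divulgedToBob h t μ : EReal) (P.divulgedToAl h t μ : EReal)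

end Classical

/-! ## Quantum protocols -/

section Quantum

/-- A vector in the space of `a` qubits of Al and `b` qubits of Bob, in the computational basis. -/
abbrev QState (a b : ℕ) : Type := (Fin a → Bool) → (Fin b → Bool) → ℂ

/-- Unitary operators on `n` qubits. -/
abbrev QUnitary (n : ℕ) : Type := Matrix.unitaryGroup (Fin n → Bool) ℂ

/-- A quantum protocol from a point at which Al owns `a` qubits and Bob owns `b` qubits.
In a round of Al he applies a unitary operator, which depends on his (classical, never erased)
input, to all qubits that he owns, and then sends some of them to Bob: `e` says which `m` of his
qubits are sent and which `k` are kept. Similarly for Bob. At the end both players measure their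
qubits in the computational basis and compute an output from input and measurement result. -/
inductive QuantumRounds (X : Type u) (Y : Type v) (W : Type w) :
    ℕ → ℕ → Type (max u v w) where
  | output {a b : ℕ} (outA : X → (Fin a → Bool) → W) (outB : Y → (Fin b → Bool) → W) :
      QuantumRounds X Y W a b
  | al {a b k m : ℕ} (U : X → QUnitary a) (e : Fin a ≃ Fin m ⊕ Fin k)
      (next : QuantumRounds X Y W k (m + b)) : QuantumRounds X Y W a b
  | bob {a b k m : ℕ} (U : Y → QUnitary b) (e : Fin b ≃ Fin m ⊕ Fin k)
      (next : QuantumRounds X Y W (m + a) k) : QuantumRounds X Y W a b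

/-- Al applies `U` to his qubits. -/
def applyAl {a b : ℕ} (U : QUnitary a) (ψ : QState a b) : QState a b :=
  fun α β => ∑ α', U.1 α α' * ψ α' β

/-- Bob applies `U` to his qubits. -/
def applyBob {a b : ℕ} (U : QUnitary b) (ψ : QState a b) : QState a b :=
  fun α β => ∑ β', U.1 β β' * ψ α β'

/-- Al hands the qubits selected by `e` over to Bob, in front of Bob's own qubits. The overall
superposition does not change, only the ownership. -/
def sendAl {a b k m : ℕ} (e : Fin a ≃ Fin m ⊕ Fin k) (ψ : QState a b) : QState k (m + b) :=
  fun α β => ψ (fun i => Sum.elim (fun j => β (Fin.castAdd b j)) α (e i))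
    (fun j => β (Fin.natAdd m j))

/-- Bob hands the qubits selected by `e` over to Al, in front of Al's own qubits. -/
def sendBob {a b k m : ℕ} (e : Fin b ≃ Fin m ⊕ Fin k) (ψ : QState a b) : QState (m + a) k :=
  fun α β => ψ (fun j => α (Fin.natAdd m j))
    (fun i => Sum.elim (fun j => α (Fin.castAdd a j)) β (e i))

/-- The state in which all qubits are `|0⟩`. -/
def initialState (a b : ℕ) : QState a b :=
  fun α β => if α = (fun _ => false) ∧ β = (fun _ => false) then 1 else 0

/-- The reduced density matrix of Al's qubits. -/
def reducedAl {a b : ℕ} (ψ : QState a b) : Matrix (Fin a → Bool) (Fin a → Bool) ℂ :=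
  fun α α' => ∑ β, ψ α β * star (ψ α' β)

/-- The reduced density matrix of Bob's qubits. -/
def reducedBob {a b : ℕ} (ψ : QState a b) : Matrix (Fin b → Bool) (Fin b → Bool) ℂ :=
  fun β β' => ∑ α, ψ α β * star (ψ α β')

variable {X : Type u} {Y : Type v} {W : Type w}

/-- The probability that both players output `z` when the rest of the protocol is run on inputs
`x, y` from the state `ψ`. -/
def QuantumRounds.successProb [DecidableEq W] (x : X) (y : Y) (z : W) :
    {a b : ℕ} → QuantumRounds X Y W a b → QState a b → ℝ
  | _, _, .output outA outB, ψ =>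
      ∑ α, ∑ β, if outA x α = z ∧ outB y β = z then ‖ψ α β‖ ^ 2 else 0
  | _, _, .al U e next, ψ => next.successProb x y z (sendAl e (applyAl (U x) ψ))
  | _, _, .bob U e next, ψ => next.successProb x y z (sendBob e (applyBob (U y) ψ))

variable [Fintype X] [Fintype Y] [Fintype W] [DecidableEq X] [DecidableEq Y] [DecidableEq W]

/-- The state `∑ μ(x,y) σ_{xy} ⊗ |x⟩⟨x| ⊗ |y, h(x,y)⟩⟨y, h(x,y)|` of the registers
`B, X, (Y, h(X,Y))` when `B` is in state `σ_{xy}` on inputs `x, y`. -/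
def cqState {B : Type*} (σ : X → Y → Matrix B B ℂ) (h : X → Y → W) (μ : X → Y → ℝ) :
    Matrix (B × X × Y × W) (B × X × Y × W) ℂ :=
  fun i j => if i.2 = j.2 ∧ i.2.2.2 = h i.2.1 i.2.2.1 then
    (μ i.2.1 i.2.2.1 : ℂ) * σ i.2.1 i.2.2.1 i.1 j.1 else 0

/-- `I(B : X | Y, h(X,Y))` for inputs drawn from `μ`, when the qubits are in the pure state `Ψ x y`
on inputs `x, y`. -/
def qDivulgedToBob {a b : ℕ} (Ψ : X → Y → QState a b) (h : X → Y → W)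
    (μ : stdSimplex ℝ (X × Y)) : ℝ :=
  qCondMutualInfo (cqState (fun x y => reducedBob (Ψ x y)) h fun x y => μ.1 (x, y))

/-- `I(A : Y | X, h(X,Y))` for inputs drawn from `μ`, when the qubits are in the pure state `Ψ x y`
on inputs `x, y`. -/
def qDivulgedToAl {a b : ℕ} (Ψ : X → Y → QState a b) (h : X → Y → W)
    (μ : stdSimplex ℝ (X × Y)) : ℝ :=
  qCondMutualInfo (cqState (fun y x => reducedAl (Ψ x y)) (fun y x => h x y) fun y x => μ.1 (x, y))

/-- The supremum of the information divulged at one point of time, over both players and all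
distributions on the inputs. -/
def qDivulged {a b : ℕ} (Ψ : X → Y → QState a b) (h : X → Y → W) : EReal :=
  ⨆ μ : stdSimplex ℝ (X × Y), max (qDivulgedToBob Ψ h μ : EReal) (qDivulgedToAl Ψ h μ : EReal)

/-- The supremum of the divulged information over the present time and the times after each of the
remaining rounds, when the present state on inputs `x, y` is `Ψ x y`. -/
def QuantumRounds.lossFrom (h : X → Y → W) :
    {a b : ℕ} → QuantumRounds X Y W a b → (X → Y → QState a b) → EReal
  | _, _, .output _ _, Ψ => qDivulged Ψ h
  | _, _, .al U e next, Ψ =>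
      max (qDivulged Ψ h) (next.lossFrom h fun x y => sendAl e (applyAl (U x) (Ψ x y)))
  | _, _, .bob U e next, Ψ =>
      max (qDivulged Ψ h) (next.lossFrom h fun x y => sendBob e (applyBob (U y) (Ψ x y)))

/-- A quantum protocol: Al starts with `a` and Bob with `b` private qubits in state `|0⟩`. -/
structure QuantumProtocol (X : Type u) (Y : Type v) (W : Type w) where
  a : ℕ
  b : ℕ
  rounds : QuantumRounds X Y W a b

/-- The protocol computes `h` with error `ε`: on every input, both players output the right value
with probability at least `1 - ε`. -/
def QuantumProtocol.Computes (P : QuantumProtocol X Y W) (ε : ℝ) (h : X → Y → W) : Prop :=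
  ∀ x y, 1 - ε ≤ P.rounds.successProb x y (h x y) (initialState P.a P.b)

/-- The privacy loss of a quantum protocol for `h`: the supremum of the divulged information over
all times, both players, and all distributions on the inputs. -/
def QuantumProtocol.privacyLoss (P : QuantumProtocol X Y W) (h : X → Y → W) : EReal :=
  P.rounds.lossFrom h fun _ _ => initialState P.a P.b

end Quantum

/-! ## Private computation and the hint sense of privacy loss -/

section Hint

variable {X : Type u} {Y : Type v} [Fintype X] [Fintype Y] [DecidableEq X] [DecidableEq Y]

/-- Some deterministic protocol computes `h` (without error) and has privacy loss `0`. -/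
def DeterministicallyPrivate {W : Type} [DecidableEq W] (h : X → Y → W) : Prop :=
  ∃ P : ClassicalProtocol X Y W, P.IsDeterministic ∧ P.Computes 0 h ∧ P.privacyLoss h = 0

/-- Some classical randomized protocol computes `h` with error `ε` and has privacy loss `0`. -/
def ClassicallyPrivate (ε : ℝ) {W : Type} [DecidableEq W] (h : X → Y → W) : Prop :=
  ∃ P : ClassicalProtocol X Y W, P.Computes ε h ∧ P.privacyLoss h = 0

/-- Some quantum protocol computes `h` with error `ε` and has privacy loss `0`. -/
def QuantumPrivate (ε : ℝ) {W : Type} [Fintype W] [DecidableEq W] (h : X → Y → W) : Prop :=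
  ∃ P : QuantumProtocol X Y W, P.Computes ε h ∧ P.privacyLoss h = 0

/-- `f` can be computed with privacy loss `k` in the hint sense, with respect to a notion `Priv` of
privately computable functions: `f(x,y)` is a function of `h(x,y)` for some privately computable
`h`, and `k` is the difference of the logarithms of the sizes of the ranges of `h` and `f`. -/
def HintComputable {Z : Type*}
    (Priv : ∀ (W : Type) [Fintype W] [DecidableEq W], (X → Y → W) → Prop)
    (f : X → Y → Z) (k : ℝ) : Prop :=
  ∃ (W : Type) (_ : Fintype W) (_ : DecidableEq W) (h : X → Y → W),
    Priv W h ∧ (∃ g : W → Z, ∀ x y, f x y = g (h x y)) ∧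
    k = Real.logb 2 (Set.range fun p : X × Y => h p.1 p.2).ncard
      - Real.logb 2 (Set.range fun p : X × Y => f p.1 p.2).ncard

/-- The privacy loss of `f` in the hint sense: the infimum of all `k` such that `f` can be computed
with privacy loss `k` in the hint sense. -/
def hintPrivacyLoss {Z : Type*}
    (Priv : ∀ (W : Type) [Fintype W] [DecidableEq W], (X → Y → W) → Prop)
    (f : X → Y → Z) : EReal :=
  ⨅ (k : ℝ) (_ : HintComputable Priv f k), (k : EReal)

/-- Hint-sense privacy loss when deterministic protocols are allowed. -/
def deterministicHintLoss {Z : Type*} (f : X → Y → Z) : EReal :=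
  hintPrivacyLoss (fun _ _ _ h => DeterministicallyPrivate h) f

/-- Hint-sense privacy loss when classical randomized protocols with error `ε` are allowed. -/
def classicalHintLoss {Z : Type*} (ε : ℝ) (f : X → Y → Z) : EReal :=
  hintPrivacyLoss (fun _ _ _ h => ClassicallyPrivate ε h) f

/-- Hint-sense privacy loss when quantum protocols with error `ε` are allowed. -/
def quantumHintLoss {Z : Type*} (ε : ℝ) (f : X → Y → Z) : EReal :=
  hintPrivacyLoss (fun _ _ _ h => QuantumPrivate ε h) f

end Hint

end TwoParty

end

/-! For each of the three kinds of protocols, private computability of `h` is equivalent to one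
combinatorial condition, `NoForbidden h`. Call two rows of a rectangle directly related if `h`
agrees on them in some column of the rectangle, and close transitively; do the same for columns. A
forbidden rectangle has all rows equivalent and all columns equivalent, but `h` is not constant on
it. Computability in the hint sense mentions protocols only through the class of privately
computable functions, so it coincides for the three kinds. The infimum is a real number because
every admissible loss is nonnegative and announcing both inputs is always private.

Without forbidden rectangles, every rectangle on which `h` is not constant can be cut by a bit that
the listener could infer from his input and the value of `h` (`NoForbidden.exists_decomposable`).
Announcing these bits is a private deterministic protocol; reversible gates on basis states carry it
out by qubits (`Decomposable.exists_quantumRounds`).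

Conversely, strict concavity of entropy, applied to a fair choice between two inputs, turns zero
information into equality of the distributions or reduced states that a player sees. On a rectangle
with connected rows and columns an invariant then survives every message. Classically, the
probability of each transcript prefix is a product of a factor for Al and a factor for Bob and is
constant on the rectangle (`ProtocolTree.outputMean_eq`). In the quantum case the cross Gram
matrices of the joint states do not depend on the other player's input (`Aligned`,
`QuantumRounds.eq_on_rectangle`). At the end neither player's output distribution depends on the
other's input, and an error below 1/2 forces `h` to be constant. -/

open scoped Matrix BigOperators

noncomputable section

namespace TwoParty

/-! ## Strict concavity of entropy -/

/-- This is strict concavity at the midpoint, multiplied by 2; halving the argument produces the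
term with `Real.log 2`. The equality case is what later identifies two distributions or two states.
-/
theorem negMulLog_add_negMulLog_le {a b : ℝ} (ha : 0 ≤ a) (hb : 0 ≤ b) :
    Real.negMulLog a + Real.negMulLog b ≤ Real.negMulLog (a + b) + (a + b) * Real.log 2 ∧
      (Real.negMulLog a + Real.negMulLog b = Real.negMulLog (a + b) + (a + b) * Real.log 2 →
        a = b) := by
  have half : Real.negMulLog ((1 / 2 : ℝ) • a + (1 / 2 : ℝ) • b) =
      (Real.negMulLog (a + b) + (a + b) * Real.log 2) / 2 := by
    have : (1 / 2 : ℝ) • a + (1 / 2 : ℝ) • b = (a + b) * (1 / 2) := by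
      simp only [smul_eq_mul]; ring
    rw [this, Real.negMulLog_mul]
    simp only [Real.negMulLog, one_div, Real.log_inv]
    ring
  have hsc := Real.strictConcaveOn_negMulLog
  constructor
  · have := hsc.concaveOn.2 ha hb (by norm_num : (0 : ℝ) ≤ 1 / 2) (by norm_num : (0 : ℝ) ≤ 1 / 2)
      (by norm_num)
    rw [half] at this
    simp only [smul_eq_mul] at this
    linarith
  · intro heq
    by_contra hne
    have := hsc.2 ha hb hne (by norm_num : (0 : ℝ) < 1 / 2) (by norm_num : (0 : ℝ) < 1 / 2)
      (by norm_num)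
    rw [half] at this
    simp only [smul_eq_mul] at this
    linarith

/-- Passing from the spectrum of a positive operator to its diagonal in an orthonormal basis
increases entropy, strictly unless the basis is an eigenbasis. -/
theorem sum_negMulLog_eigenvalues_le {ι E : Type*} [Fintype ι] [NormedAddCommGroup E]
    [InnerProductSpace ℂ E] (T : E →ₗ[ℂ] E) (e f : OrthonormalBasis ι ℂ E) (l s : ι → ℝ)
    (hl : ∀ j, 0 ≤ l j) (hT : ∀ j, T (f j) = (l j : ℂ) • f j)
    (hs : ∀ i, inner ℂ (e i) (T (e i)) = (s i : ℂ)) :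
    ∑ j, Real.negMulLog (l j) ≤ ∑ i, Real.negMulLog (s i) ∧
      (∑ j, Real.negMulLog (l j) = ∑ i, Real.negMulLog (s i) →
        ∀ i, T (e i) = (s i : ℂ) • e i) := by
  -- The squared overlaps of the two bases form a doubly stochastic matrix with `s = D l`. Jensen is
  -- applied in each row; the column sums recover the entropy of `l`.
  set D : ι → ι → ℝ := fun i j => ‖inner ℂ (f j) (e i)‖ ^ 2 with hD
  have hD0 : ∀ i j, 0 ≤ D i j := fun i j => by positivity
  have hDr : ∀ i, ∑ j, D i j = 1 := fun i => by
    simp [hD, f.sum_sq_norm_inner_right]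
  have hDc : ∀ j, ∑ i, D i j = 1 := fun j => by
    simp [hD, e.sum_sq_norm_inner_left]
  have hTe : ∀ i, T (e i) = ∑ j, (l j * inner ℂ (f j) (e i) : ℂ) • f j := fun i => by
    conv_lhs => rw [← f.sum_repr' (e i)]
    rw [map_sum]
    refine Finset.sum_congr rfl fun j _ => ?_
    rw [map_smul, hT, smul_smul, mul_comm]
  have hsD : ∀ i, s i = ∑ j, D i j • l j := fun i => by
    have h1 := hs i
    rw [hTe, inner_sum] at h1
    have h2 : ∀ j, inner ℂ (e i) ((l j * inner ℂ (f j) (e i) : ℂ) • f j) =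
        ((D i j • l j : ℝ) : ℂ) := fun j => by
      rw [inner_smul_right, mul_assoc, ← inner_conj_symm (e i) (f j), RCLike.mul_conj]
      simp [hD, mul_comm]
    simp only [h2] at h1
    exact_mod_cast h1.symm
  have hsc := Real.strictConcaveOn_negMulLog
  have hterm : ∀ i, ∑ j, D i j • Real.negMulLog (l j) ≤ Real.negMulLog (s i) := fun i => by
    rw [hsD i]
    exact hsc.concaveOn.le_map_sum (fun j _ => hD0 i j) (hDr i) (fun j _ => hl j)
  have hsum : ∑ j, Real.negMulLog (l j) = ∑ i, ∑ j, D i j • Real.negMulLog (l j) := by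
    rw [Finset.sum_comm]
    simp [← Finset.sum_mul, hDc]
  refine ⟨hsum ▸ Finset.sum_le_sum fun i _ => hterm i, fun heq i => ?_⟩
  rw [hsum, Finset.sum_eq_sum_iff_of_le fun i _ => hterm i] at heq
  have h1 := heq i (Finset.mem_univ _)
  rw [hsD i] at h1
  -- Equality in Jensen forces `l j = s i` wherever `e i` overlaps `f j`, so `e i` lies in the
  -- eigenspace of `s i`.
  have h2 := (hsc.map_sum_eq_iff' (fun j _ => hD0 i j) (hDr i) (fun j _ => hl j)).1 h1.symm
  rw [← hsD i] at h2
  rw [hTe]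
  conv_rhs => rw [← f.sum_repr' (e i), Finset.smul_sum]
  refine Finset.sum_congr rfl fun j _ => ?_
  rw [smul_smul]
  by_cases hj : inner ℂ (f j) (e i) = 0
  · simp [hj]
  · rw [h2 j (Finset.mem_univ _) (by simpa [hD] using hj)]

/-! ## Von Neumann entropy -/

section VonNeumann

open scoped ComplexOrder

variable {S T : Type*} [Fintype S] [DecidableEq S] [Fintype T] [DecidableEq T]

theorem vonNeumannEntropy_eq_sum_eigenvalues {A : Matrix S S ℂ} (hA : A.IsHermitian) :
    vonNeumannEntropy A = (∑ i, Real.negMulLog (hA.eigenvalues i)) / Real.log 2 := by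
  rw [vonNeumannEntropy, hA.roots_charpoly_eq_eigenvalues, Finset.sum_div, Multiset.map_map]
  rfl

theorem toEuclideanLin_eigenvectorBasis {A : Matrix S S ℂ} (hA : A.IsHermitian) (j : S) :
    A.toEuclideanLin (hA.eigenvectorBasis j) =
      (hA.eigenvalues j : ℂ) • hA.eigenvectorBasis j := by
  ext k
  have := congrFun (hA.mulVec_eigenvectorBasis j) k
  simpa [Matrix.toEuclideanLin] using this

theorem vonNeumannEntropy_le_diagonal {A : Matrix S S ℂ} (hA : A.PosSemidef)
    (e : OrthonormalBasis S ℂ (EuclideanSpace ℂ S)) (s : S → ℝ)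
    (hs : ∀ i, inner ℂ (e i) (A.toEuclideanLin (e i)) = (s i : ℂ)) :
    vonNeumannEntropy A ≤ (∑ i, Real.negMulLog (s i)) / Real.log 2 ∧
      (vonNeumannEntropy A = (∑ i, Real.negMulLog (s i)) / Real.log 2 →
        ∀ i, A.toEuclideanLin (e i) = (s i : ℂ) • e i) := by
  have hlog : 0 < Real.log 2 := Real.log_pos (by norm_num)
  have key := sum_negMulLog_eigenvalues_le A.toEuclideanLin e hA.1.eigenvectorBasis
    hA.1.eigenvalues s hA.eigenvalues_nonneg (toEuclideanLin_eigenvectorBasis hA.1) hs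
  rw [vonNeumannEntropy_eq_sum_eigenvalues hA.1, div_le_div_iff_of_pos_right hlog,
    div_left_inj' hlog.ne']
  exact key

theorem inner_toEuclideanLin_self {A : Matrix S S ℂ} (hA : A.PosSemidef)
    (v : EuclideanSpace ℂ S) :
    ∃ r : ℝ, 0 ≤ r ∧ inner ℂ v (A.toEuclideanLin v) = (r : ℂ) := by
  have h := (Matrix.posSemidef_iff_dotProduct_mulVec.1 hA).2 v.ofLp
  obtain ⟨r, hr, h2⟩ := RCLike.nonneg_iff_exists_ofReal.1 h
  refine ⟨r, hr, ?_⟩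
  rw [EuclideanSpace.inner_eq_star_dotProduct, dotProduct_comm]
  exact h2.symm

/-- In an eigenbasis of `P + Q` the diagonals `s`, `t` of `P`, `Q` add up to the eigenvalues.
Passing to diagonals does not decrease entropy, and the scalar midpoint inequality bounds the
result. The hypothesis closes this chain, so `P` and `Q` are both diagonal in this basis with `s =
t`. -/
theorem eq_of_vonNeumannEntropy_add_le {P Q : Matrix S S ℂ} (hP : P.PosSemidef)
    (hQ : Q.PosSemidef)
    (h : vonNeumannEntropy (P + Q) + (P + Q).trace.re ≤
      vonNeumannEntropy P + vonNeumannEntropy Q) : P = Q := by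
  have hlog : 0 < Real.log 2 := Real.log_pos (by norm_num)
  have hPQ := hP.add hQ
  set e := hPQ.1.eigenvectorBasis with he
  choose s hs0 hs using fun i => inner_toEuclideanLin_self hP (e i)
  choose t ht0 ht using fun i => inner_toEuclideanLin_self hQ (e i)
  have hst : ∀ i, hPQ.1.eigenvalues i = s i + t i := fun i => by
    have h1 : (P + Q).toEuclideanLin (e i) = (hPQ.1.eigenvalues i : ℂ) • e i :=
      toEuclideanLin_eigenvectorBasis hPQ.1 i
    have h2 : inner ℂ (e i) ((P + Q).toEuclideanLin (e i)) = ((s i + t i : ℝ) : ℂ) := by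
      rw [map_add, LinearMap.add_apply, inner_add_right, hs, ht]
      push_cast; rfl
    rw [h1, inner_smul_right, inner_self_eq_norm_sq_to_K] at h2
    simp only [e.norm_eq_one] at h2
    simpa using congrArg Complex.re h2
  obtain ⟨hP1, hP2⟩ := vonNeumannEntropy_le_diagonal hP e s hs
  obtain ⟨hQ1, hQ2⟩ := vonNeumannEntropy_le_diagonal hQ e t ht
  have htr : (P + Q).trace.re = ∑ i, (s i + t i) := by
    rw [hPQ.1.trace_eq_sum_eigenvalues]
    simp [hst]
  rw [vonNeumannEntropy_eq_sum_eigenvalues hPQ.1, htr] at h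
  simp only [hst] at h
  have hterm : ∀ i ∈ Finset.univ, Real.negMulLog (s i) + Real.negMulLog (t i) ≤
      Real.negMulLog (s i + t i) + (s i + t i) * Real.log 2 :=
    fun i _ => (negMulLog_add_negMulLog_le (hs0 i) (ht0 i)).1
  have hle := Finset.sum_le_sum hterm
  have hR : (∑ i, (Real.negMulLog (s i + t i) + (s i + t i) * Real.log 2)) / Real.log 2 =
      (∑ i, Real.negMulLog (s i + t i)) / Real.log 2 + ∑ i, (s i + t i) := by
    rw [Finset.sum_add_distrib, ← Finset.sum_mul, add_div, mul_div_cancel_right₀ _ hlog.ne']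
  have hL : (∑ i, (Real.negMulLog (s i) + Real.negMulLog (t i))) / Real.log 2 =
      (∑ i, Real.negMulLog (s i)) / Real.log 2 + (∑ i, Real.negMulLog (t i)) / Real.log 2 := by
    rw [Finset.sum_add_distrib, add_div]
  have hle' := div_le_div_of_nonneg_right hle hlog.le
  rw [hR, hL] at hle'
  have hPe := hP2 (by linarith)
  have hQe := hQ2 (by linarith)
  have heq : ∑ i, (Real.negMulLog (s i) + Real.negMulLog (t i)) =
      ∑ i, (Real.negMulLog (s i + t i) + (s i + t i) * Real.log 2) := by
    rw [← div_left_inj' hlog.ne', hL, hR]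
    linarith
  rw [Finset.sum_eq_sum_iff_of_le hterm] at heq
  have hst' : ∀ i, s i = t i := fun i =>
    (negMulLog_add_negMulLog_le (hs0 i) (ht0 i)).2 (heq i (Finset.mem_univ _))
  apply (Matrix.toEuclideanLin (𝕜 := ℂ) (m := S) (n := S)).injective
  refine e.toBasis.ext fun i => ?_
  rw [e.coe_toBasis, hPe, hQe, hst']

/-- Entropy is defined through the roots of the characteristic polynomial, so this factorization
makes it additive over blocks. -/
theorem charpoly_blockDiagonal {R : Type*} [CommRing R] (M : T → Matrix S S R) :
    (Matrix.blockDiagonal M).charpoly = ∏ k, (M k).charpoly := by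
  have : (Matrix.blockDiagonal M).charmatrix = Matrix.blockDiagonal fun k => (M k).charmatrix := by
    ext ⟨i, k⟩ ⟨j, l⟩
    by_cases hkl : k = l
    · subst hkl
      simp [Matrix.charmatrix, Matrix.blockDiagonal_apply, Matrix.diagonal_apply]
    · simp [Matrix.charmatrix, Matrix.blockDiagonal_apply, hkl]
  simp only [Matrix.charpoly, this, Matrix.det_blockDiagonal]

theorem vonNeumannEntropy_blockDiagonal (M : T → Matrix S S ℂ) :
    vonNeumannEntropy (Matrix.blockDiagonal M) = ∑ k, vonNeumannEntropy (M k) := by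
  rw [vonNeumannEntropy, charpoly_blockDiagonal, Polynomial.roots_prod _ _
    (Finset.prod_ne_zero_iff.2 fun k _ => (Matrix.charpoly_monic _).ne_zero), Multiset.map_bind,
    Multiset.sum_bind]
  rfl

theorem vonNeumannEntropy_diagonal (d : S → ℝ) :
    vonNeumannEntropy (Matrix.diagonal fun i => (d i : ℂ)) =
      (∑ i, Real.negMulLog (d i)) / Real.log 2 := by
  rw [vonNeumannEntropy, Matrix.charpoly_diagonal, Polynomial.roots_prod _ _
    (Finset.prod_ne_zero_iff.2 fun k _ => Polynomial.X_sub_C_ne_zero _), Multiset.map_bind,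
    Multiset.sum_bind, Finset.sum_div]
  simp

@[simp]
theorem vonNeumannEntropy_zero : vonNeumannEntropy (0 : Matrix S S ℂ) = 0 := by
  have := vonNeumannEntropy_diagonal (fun _ : S => 0)
  simpa using this

end VonNeumann

/-! ### Information carried by a quantum register about classical inputs. -/

section ClassicalQuantum

open scoped ComplexOrder

variable {X Y W B : Type*} [DecidableEq X] [DecidableEq Y] [DecidableEq W]

theorem cqState_eq_blockDiagonal (σ : X → Y → Matrix B B ℂ) (h : X → Y → W) (μ : X → Y → ℝ) :
    cqState σ h μ = Matrix.blockDiagonal fun i : X × Y × W =>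
      if i.2.2 = h i.1 i.2.1 then (μ i.1 i.2.1 : ℂ) • σ i.1 i.2.1 else 0 := by
  ext ⟨b, i⟩ ⟨b', j⟩
  simp only [cqState, Matrix.blockDiagonal_apply]
  by_cases hij : i = j
  · by_cases hw : i.2.2 = h i.1 i.2.1
    · rw [if_pos ⟨hij, hw⟩, if_pos hij, if_pos hw]; rfl
    · rw [if_neg (fun h => hw h.2), if_pos hij, if_neg hw]; rfl
  · rw [if_neg (fun h => hij h.1), if_neg hij]

variable [Fintype X] [Fintype Y] [Fintype W] [Fintype B] [DecidableEq B]

/-- All marginals involved are block diagonal or diagonal. As the last register is a function of the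
inputs, sums over `(x, y, w)` collapse to sums over `(x, y)`. The blocks stay unnormalized, so their
entropies include the Shannon part. -/
theorem qCondMutualInfo_cqState (σ : X → Y → Matrix B B ℂ) (hσ : ∀ x y, (σ x y).trace = 1)
    (h : X → Y → W) (μ : X → Y → ℝ) :
    qCondMutualInfo (cqState σ h μ) =
      (∑ i : Y × W, vonNeumannEntropy
        (∑ x, if i.2 = h x i.1 then (μ x i.1 : ℂ) • σ x i.1 else 0)) +
      (∑ x, ∑ y, Real.negMulLog (μ x y)) / Real.log 2 -
      (∑ i : Y × W, Real.negMulLog (∑ x, if i.2 = h x i.1 then μ x i.1 else 0)) / Real.log 2 -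
      ∑ x, ∑ y, vonNeumannEntropy ((μ x y : ℂ) • σ x y) := by
  have h1 : traceMid (cqState σ h μ) = Matrix.blockDiagonal fun i : Y × W =>
      ∑ x, if i.2 = h x i.1 then (μ x i.1 : ℂ) • σ x i.1 else 0 := by
    ext ⟨b, i⟩ ⟨b', j⟩
    simp only [traceMid, cqState_eq_blockDiagonal, Matrix.blockDiagonal_apply, Prod.mk.injEq,
      true_and]
    by_cases hij : i = j
    · simp [hij, Matrix.sum_apply]
    · simp [hij]
  have h2 : traceFst (cqState σ h μ) = Matrix.diagonal fun i : X × Y × W =>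
      ((if i.2.2 = h i.1 i.2.1 then μ i.1 i.2.1 else 0 : ℝ) : ℂ) := by
    ext i j
    simp only [traceFst, cqState_eq_blockDiagonal, Matrix.blockDiagonal_apply,
      Matrix.diagonal_apply]
    by_cases hij : i = j
    · subst hij
      by_cases hw : i.2.2 = h i.1 i.2.1
      · have := hσ i.1 i.2.1
        rw [Matrix.trace] at this
        simp only [Matrix.diag_apply] at this
        simp [hw, ← Finset.mul_sum, this]
      · simp [hw]
    · simp [hij]
  have h3 : traceFst (traceFst (cqState σ h μ)) = Matrix.diagonal fun i : Y × W =>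
      ((∑ x, if i.2 = h x i.1 then μ x i.1 else 0 : ℝ) : ℂ) := by
    ext i j
    rw [h2]
    simp only [traceFst, Matrix.diagonal_apply, Prod.mk.injEq, true_and]
    by_cases hij : i = j <;> simp [hij]
  rw [qCondMutualInfo, h3, h1, h2, cqState_eq_blockDiagonal, vonNeumannEntropy_blockDiagonal,
    vonNeumannEntropy_blockDiagonal, vonNeumannEntropy_diagonal, vonNeumannEntropy_diagonal]
  congr 2
  · congr 2
    simp only [Fintype.sum_prod_type, apply_ite Real.negMulLog, Real.negMulLog_zero,
      Finset.sum_ite_eq', Finset.mem_univ, if_true]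
  · simp only [Fintype.sum_prod_type, apply_ite vonNeumannEntropy, vonNeumannEntropy_zero,
      Finset.sum_ite_eq', Finset.mem_univ, if_true]

/-- If register `B` holds a basis state determined by `(y, h x y)`, nothing is divulged. -/
theorem qCondMutualInfo_cqState_eq_zero (β : X → Y → B) (h : X → Y → W)
    (hβ : ∀ x x' y, h x y = h x' y → β x y = β x' y) (μ : X → Y → ℝ) :
    qCondMutualInfo (cqState
      (fun x y => Matrix.diagonal fun b => ((if b = β x y then 1 else 0 : ℝ) : ℂ)) h μ) = 0 := by
  have hlog : Real.log 2 ≠ 0 := (Real.log_pos (by norm_num)).ne'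
  have smul_diag : ∀ (c : ℝ) (d : B → ℝ), (c : ℂ) • Matrix.diagonal (fun b => (d b : ℂ)) =
      Matrix.diagonal fun b => ((c * d b : ℝ) : ℂ) := fun c d => by
    ext i j
    by_cases hij : i = j <;> simp [hij]
  have point : ∀ (c : ℝ) (b₀ : B),
      ∑ b, Real.negMulLog (c * if b = b₀ then 1 else 0) = Real.negMulLog c := fun c b₀ => by
    rw [Finset.sum_eq_single b₀] <;> simp +contextual
  rw [qCondMutualInfo_cqState _ (fun x y => by simp [Matrix.trace_diagonal, apply_ite Complex.ofReal])]
  simp only [smul_diag, vonNeumannEntropy_diagonal, point]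
  -- On the fibre of `(y, w)` the vector `β x y` is constant, so the block is a multiple of one
  -- basis projector and has the entropy of its weight. The four terms then cancel in pairs.
  have key : ∀ i : Y × W, vonNeumannEntropy (∑ x, if i.2 = h x i.1 then
      Matrix.diagonal fun b => ((μ x i.1 * if b = β x i.1 then 1 else 0 : ℝ) : ℂ) else 0) =
      Real.negMulLog (∑ x, if i.2 = h x i.1 then μ x i.1 else 0) / Real.log 2 := by
    rintro ⟨y, w⟩
    by_cases hx : ∃ x₀, w = h x₀ y
    · obtain ⟨x₀, hx₀⟩ := hx
      have : (∑ x, if w = h x y then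
          Matrix.diagonal fun b => ((μ x y * if b = β x y then 1 else 0 : ℝ) : ℂ) else 0) =
          Matrix.diagonal fun b => (((∑ x, if w = h x y then μ x y else 0) *
            if b = β x₀ y then 1 else 0 : ℝ) : ℂ) := by
        ext i j
        rw [Matrix.sum_apply]
        by_cases hij : i = j
        · subst hij
          simp only [Matrix.diagonal_apply_eq, Finset.sum_mul]
          push_cast
          refine Finset.sum_congr rfl fun x _ => ?_
          by_cases hw : w = h x y
          · rw [hβ x x₀ y (hw.symm.trans hx₀)]
            simp [hw]
          · simp [hw]
        · rw [Matrix.diagonal_apply_ne _ hij]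
          refine Finset.sum_eq_zero fun x _ => ?_
          split_ifs <;> simp [hij]
      simp only [this, vonNeumannEntropy_diagonal, point]
    · push Not at hx
      simp [hx]
  simp only [key, ← Finset.sum_div]
  ring

/-- If nothing is divulged for any distribution on the inputs, then the state of `B` on inputs
`x, y` is determined by `(y, h x y)`. -/
theorem eq_of_qCondMutualInfo_nonpos {σ : X → Y → Matrix B B ℂ}
    (hpos : ∀ x y, (σ x y).PosSemidef) (htr : ∀ x y, (σ x y).trace = 1) {h : X → Y → W}
    (hpriv : ∀ μ : X → Y → ℝ, (∀ x y, 0 ≤ μ x y) → ∑ x, ∑ y, μ x y = 1 →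
      qCondMutualInfo (cqState σ h μ) ≤ 0)
    {x₁ x₂ : X} {y₀ : Y} (hh : h x₁ y₀ = h x₂ y₀) : σ x₁ y₀ = σ x₂ y₀ := by
  by_cases hne : x₁ = x₂
  · rw [hne]
  -- Under the uniform distribution on the two inputs, `Y` and `h(X,Y)` are constant. With `P`, `Q`
  -- the halves of the two states, the information is `S(P + Q) + 1 - S(P) - S(Q)`, and 1 is the
  -- trace of `P + Q`.
  set μ : X → Y → ℝ := fun x y => if y = y₀ ∧ (x = x₁ ∨ x = x₂) then 1 / 2 else 0 with hμ
  have m1 : μ x₁ y₀ = 1 / 2 := by simp [hμ]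
  have m2 : μ x₂ y₀ = 1 / 2 := by simp [hμ]
  have mx : ∀ x, x ≠ x₁ ∧ x ≠ x₂ → ∀ y, μ x y = 0 := fun x hx y => by simp [hμ, hx.1, hx.2]
  have my : ∀ y, y ≠ y₀ → ∀ x, μ x y = 0 := fun y hy x => by simp [hμ, hy]
  have double : ∀ F : X → Y → ℝ, (∀ x y, μ x y = 0 → F x y = 0) →
      ∑ x, ∑ y, F x y = F x₁ y₀ + F x₂ y₀ := fun F hF => by
    rw [Fintype.sum_eq_add x₁ x₂ hne fun x hx => Finset.sum_eq_zero fun y _ => hF _ _ (mx x hx y),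
      Fintype.sum_eq_single y₀ fun y hy => hF _ _ (my y hy _),
      Fintype.sum_eq_single y₀ fun y hy => hF _ _ (my y hy _)]
  have hI := hpriv μ (fun x y => by simp only [hμ]; split_ifs <;> norm_num) (by
    rw [double μ fun _ _ h => h, m1, m2]; norm_num)
  have hlog : Real.log 2 ≠ 0 := (Real.log_pos (by norm_num)).ne'
  have hhalf : (Real.negMulLog (1 / 2) + Real.negMulLog (1 / 2)) / Real.log 2 = 1 := by
    rw [Real.negMulLog, one_div, Real.log_inv]
    field_simp
    norm_num
  rw [qCondMutualInfo_cqState σ htr, double (fun x y => Real.negMulLog (μ x y))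
      (fun x y h => by simp [h]), double (fun x y => vonNeumannEntropy ((μ x y : ℂ) • σ x y))
      (fun x y h => by simp [h]), m1, m2, hhalf,
    Fintype.sum_eq_single (y₀, h x₁ y₀), Fintype.sum_eq_single (y₀, h x₁ y₀)] at hI
  rotate_left
  · rintro ⟨y, w⟩ hyw
    rw [Finset.sum_eq_zero, Real.negMulLog_zero]
    intro x _
    split_ifs with hw
    · by_contra hx
      simp only [hμ, ite_eq_right_iff, Classical.not_imp] at hx
      obtain ⟨⟨rfl, rfl | rfl⟩, -⟩ := hx
      · exact hyw (Prod.ext rfl hw)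
      · exact hyw (Prod.ext rfl (hw.trans hh.symm))
    · rfl
  · rintro ⟨y, w⟩ hyw
    rw [Finset.sum_eq_zero, vonNeumannEntropy_zero]
    intro x _
    split_ifs with hw
    · suffices μ x y = 0 by simp [this]
      by_contra hx
      simp only [hμ, ite_eq_right_iff, Classical.not_imp] at hx
      obtain ⟨⟨rfl, rfl | rfl⟩, -⟩ := hx
      · exact hyw (Prod.ext rfl hw)
      · exact hyw (Prod.ext rfl (hw.trans hh.symm))
    · rfl
  rw [Fintype.sum_eq_add x₁ x₂ hne fun x hx => by simp [mx x hx],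
    Fintype.sum_eq_add x₁ x₂ hne fun x hx => by simp [mx x hx]] at hI
  simp only [if_true, ← hh, m1, m2] at hI
  rw [show (1 / 2 + 1 / 2 : ℝ) = 1 by norm_num, Real.negMulLog_one, zero_div, sub_zero] at hI
  have hc : (0 : ℂ) ≤ ((1 / 2 : ℝ) : ℂ) := by
    rw [Complex.zero_le_real]; norm_num
  have hPQ := eq_of_vonNeumannEntropy_add_le ((hpos x₁ y₀).smul hc) ((hpos x₂ y₀).smul hc) (by
    rw [Matrix.trace_add, Matrix.trace_smul, Matrix.trace_smul, htr, htr]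
    norm_num at hI ⊢
    linarith)
  exact smul_right_injective _ (by norm_num : ((1 / 2 : ℝ) : ℂ) ≠ 0) hPQ

end ClassicalQuantum

/-! ## Decomposable functions -/

section Decomposable

variable {X Y W : Type*}

/-- The bit `c x` may be announced on the rectangle `S × T`: it is determined by `(y, h x y)`. -/
def RowSplit (h : X → Y → W) (S : Set X) (T : Set Y) (c : X → Bool) : Prop :=
  ∀ x ∈ S, ∀ x' ∈ S, ∀ y ∈ T, h x y = h x' y → c x = c x'

/-- All rows of `S × T` are equivalent under the closure of `h x y = h x' y` for some `y`. -/
def RowConnected (h : X → Y → W) (S : Set X) (T : Set Y) : Prop :=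
  ∀ c : X → Bool, RowSplit h S T c → ∀ x ∈ S, ∀ x' ∈ S, c x = c x'

/-- There are no forbidden rectangles: whenever all rows and all columns of a rectangle are
equivalent, the function is constant on it. -/
def NoForbidden (h : X → Y → W) : Prop :=
  ∀ (S : Set X) (T : Set Y), RowConnected h S T → RowConnected (fun y x => h x y) T S →
    ∀ x ∈ S, ∀ y ∈ T, ∀ x' ∈ S, ∀ y' ∈ T, h x y = h x' y'

/-- The rectangle `S × T` can be cut into monochromatic ones by at most `n` rounds of row splits
followed by column splits. -/
def Decomposable (h : X → Y → W) : ℕ → Set X → Set Y → Prop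
  | 0, S, T => ∃ w, ∀ x ∈ S, ∀ y ∈ T, h x y = w
  | n + 1, S, T => ∃ c, RowSplit h S T c ∧ ∀ b, ∃ d,
      RowSplit (fun y x => h x y) T {x ∈ S | c x = b} d ∧
        ∀ b', Decomposable h n {x ∈ S | c x = b} {y ∈ T | d y = b'}

theorem RowSplit.mono {h : X → Y → W} {S S' : Set X} {T T' : Set Y} {c : X → Bool}
    (hc : RowSplit h S T c) (hS : S' ⊆ S) (hT : T' ⊆ T) : RowSplit h S' T' c :=
  fun x hx x' hx' y hy => hc x (hS hx) x' (hS hx') y (hT hy)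

theorem rowSplit_const (h : X → Y → W) (S : Set X) (T : Set Y) :
    RowSplit h S T fun _ => true :=
  fun _ _ _ _ _ _ _ => rfl

theorem Decomposable.mono {h : X → Y → W} {n : ℕ} {S S' : Set X} {T T' : Set Y}
    (hD : Decomposable h n S T) (hS : S' ⊆ S) (hT : T' ⊆ T) : Decomposable h n S' T' := by
  induction n generalizing S S' T T' with
  | zero =>
    obtain ⟨w, hw⟩ := hD
    exact ⟨w, fun x hx y hy => hw x (hS hx) y (hT hy)⟩
  | succ n ih =>
    obtain ⟨c, hc, hD⟩ := hD
    refine ⟨c, hc.mono hS hT, fun b => ?_⟩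
    obtain ⟨d, hd, hD⟩ := hD b
    have hS' : {x ∈ S' | c x = b} ⊆ {x ∈ S | c x = b} := fun x hx => ⟨hS hx.1, hx.2⟩
    exact ⟨d, hd.mono hT hS', fun b' => ih (hD b') hS' fun y hy => ⟨hT hy.1, hy.2⟩⟩

/-- A round of constant announcements is padding; it allows both halves of a split to be given the
same depth. -/
theorem Decomposable.succ {h : X → Y → W} {n : ℕ} {S : Set X} {T : Set Y}
    (hD : Decomposable h n S T) : Decomposable h (n + 1) S T :=
  ⟨_, rowSplit_const h S T, fun _ => ⟨_, rowSplit_const _ _ _, fun _ =>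
    hD.mono (fun _ hx => hx.1) fun _ hy => hy.1⟩⟩

theorem Decomposable.of_le {h : X → Y → W} {n m : ℕ} {S : Set X} {T : Set Y}
    (hD : Decomposable h n S T) (hnm : n ≤ m) : Decomposable h m S T := by
  induction hnm with
  | refl => exact hD
  | step _ ih => exact ih.succ

theorem Decomposable.of_rowSplit {h : X → Y → W} {S : Set X} {T : Set Y} {c : X → Bool}
    (hc : RowSplit h S T c) (hD : ∀ b, ∃ n, Decomposable h n {x ∈ S | c x = b} T) :
    ∃ n, Decomposable h n S T := by
  choose n hn using hD
  refine ⟨max (n false) (n true) + 1, c, hc, fun b => ⟨_, rowSplit_const _ _ _, fun b' => ?_⟩⟩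
  refine ((hn b).of_le ?_).mono subset_rfl fun y hy => hy.1
  cases b <;> simp

theorem Decomposable.of_columnSplit {h : X → Y → W} {S : Set X} {T : Set Y} {d : Y → Bool}
    (hd : RowSplit (fun y x => h x y) T S d)
    (hD : ∀ b, ∃ n, Decomposable h n S {y ∈ T | d y = b}) :
    ∃ n, Decomposable h n S T := by
  choose n hn using hD
  refine ⟨max (n false) (n true) + 1, _, rowSplit_const h S T, fun b => ⟨d, hd.mono subset_rfl
    fun x hx => hx.1, fun b' => ?_⟩⟩
  refine ((hn b').of_le ?_).mono (fun x hx => hx.1) subset_rfl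
  cases b' <;> simp

theorem ncard_sep_lt {α : Type*} [Finite α] {S : Set α} {c : α → Bool} {x x' : α} (hx : x ∈ S)
    (hx' : x' ∈ S) (hne : c x ≠ c x') (b : Bool) : {x ∈ S | c x = b}.ncard < S.ncard := by
  refine Set.ncard_lt_ncard ⟨fun x hx => hx.1, fun hsub => hne ?_⟩
  rw [(hsub hx).2, (hsub hx').2]

/-- Failure of connectedness is by definition a nonconstant admissible bit, and cutting along it
leaves two strictly smaller rectangles. If rows and columns are both connected, the rectangle is
already monochromatic. -/
theorem NoForbidden.exists_decomposable [Finite X] [Finite Y] [Nonempty W] {h : X → Y → W}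
    (hh : NoForbidden h) (S : Set X) (T : Set Y) : ∃ n, Decomposable h n S T := by
  induction hk : S.ncard + T.ncard using Nat.strong_induction_on generalizing S T with
  | _ k ih =>
    subst hk
    by_cases hrow : RowConnected h S T
    · by_cases hcol : RowConnected (fun y x => h x y) T S
      · have hconst := hh S T hrow hcol
        refine ⟨0, ?_⟩
        by_cases hne : S.Nonempty ∧ T.Nonempty
        · obtain ⟨⟨x₀, hx₀⟩, y₀, hy₀⟩ := hne
          exact ⟨h x₀ y₀, fun x hx y hy => hconst x hx y hy x₀ hx₀ y₀ hy₀⟩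
        -- An empty rectangle still needs a value to announce.
        · exact ⟨Classical.arbitrary W, fun x hx y hy => (hne ⟨⟨x, hx⟩, y, hy⟩).elim⟩
      · simp only [RowConnected, not_forall] at hcol
        obtain ⟨d, hd, y, hy, y', hy', hne⟩ := hcol
        exact Decomposable.of_columnSplit hd fun b =>
          ih _ (Nat.add_lt_add_left (ncard_sep_lt hy hy' hne b) _) _ _ rfl
    · simp only [RowConnected, not_forall] at hrow
      obtain ⟨c, hc, x, hx, x', hx', hne⟩ := hrow
      exact Decomposable.of_rowSplit hc fun b =>
        ih _ (Nat.add_lt_add_right (ncard_sep_lt hx hx' hne b) _) _ _ rfl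

/-- Induction along equivalent rows. -/
theorem RowConnected.rel {h : X → Y → W} {S : Set X} {T : Set Y} (hS : RowConnected h S T)
    {α : Type*} (F : X → α)
    (hr : ∀ x ∈ S, ∀ x' ∈ S, ∀ y ∈ T, h x y = h x' y → F x = F x') :
    ∀ x ∈ S, ∀ x' ∈ S, F x = F x' := by
  classical
  intro x hx x' hx'
  -- The indicator of the level set of `F` through `x` is an admissible bit, hence constant.
  have := hS (fun z => decide (F z = F x)) (fun z hz z' hz' y hy hzz => by
    simp only [hr z hz z' hz' y hy hzz]) x hx x' hx'
  simpa [eq_comm] using this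

end Decomposable

/-! ## Quantum protocols compute only decomposable functions -/

section QuantumLower

open scoped ComplexOrder

/-- Equal Gram matrices give `‖v M‖ = ‖v N‖` for all row vectors `v`, so `v N ↦ v M` is well defined
on the row space of `N`. Any linear extension serves as `V`; unitarity is not needed. -/
theorem exists_eq_mul_of_mul_conjTranspose_eq {I B : Type*} [Fintype I] [Fintype B]
    [DecidableEq I] [DecidableEq B]
    {M N : Matrix I B ℂ} (h : M * Mᴴ = N * Nᴴ) : ∃ V : Matrix B B ℂ, M = N * V := by
  have hker : ∀ v, v ᵥ* N = 0 → v ᵥ* M = 0 := by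
    intro v hv
    have h1 : v ᵥ* (M * Mᴴ) ⬝ᵥ star v = 0 := by
      rw [h, ← Matrix.vecMul_vecMul, hv]; simp
    rw [← Matrix.vecMul_vecMul, ← Matrix.dotProduct_mulVec, ← Matrix.star_vecMul] at h1
    exact dotProduct_self_star_eq_zero.1 h1
  obtain ⟨r, hr⟩ := N.vecMulLinear.rangeRestrict.exists_rightInverse_of_surjective
    N.vecMulLinear.range_rangeRestrict
  obtain ⟨g, hg⟩ := LinearMap.exists_extend (M.vecMulLinear ∘ₗ r)
  have hNM : ∀ v, g (v ᵥ* N) = v ᵥ* M := fun v => by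
    have h1 := LinearMap.congr_fun hg (N.vecMulLinear.rangeRestrict v)
    have h2 := congrArg Subtype.val (LinearMap.congr_fun hr (N.vecMulLinear.rangeRestrict v))
    simp only [LinearMap.comp_apply, Submodule.subtype_apply, LinearMap.codRestrict_apply,
      LinearMap.rangeRestrict, Matrix.vecMulLinear_apply, LinearMap.id_apply] at h1 h2
    rw [h1, ← sub_eq_zero, ← Matrix.sub_vecMul]
    exact hker _ (by rw [Matrix.sub_vecMul, sub_eq_zero]; exact h2)
  refine ⟨(LinearMap.toMatrix' g)ᵀ, ?_⟩
  ext i b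
  have h1 := congrFun (hNM (Pi.single i 1)) b
  rw [Matrix.single_one_vecMul, Matrix.single_one_vecMul, ← LinearMap.toMatrix'_mulVec,
    ← Matrix.vecMul_transpose] at h1
  exact h1.symm

/-- On the rectangle `S × T`, column changes act on the states `Ψ x y` by an operator on the
second register that does not depend on the row, in terms of Gram matrices. -/
def Aligned {X Y A B : Type*} [Fintype B] (Ψ : X → Y → Matrix A B ℂ) (S : Set X) (T : Set Y) :
    Prop :=
  ∀ x ∈ S, ∀ x' ∈ S, ∀ y ∈ T, ∀ y' ∈ T, Ψ x y * (Ψ x' y)ᴴ = Ψ x y' * (Ψ x' y')ᴴ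

/-- By alignment, moving from column `y₀` to `y` multiplies every state by a common operator `V y`
on the second register. The transposed Gram matrix at `x` is therefore a fixed expression in the
second reduced state at `(x, y₀)`, which privacy equates for rows related in that column.
Connectedness spreads this over `S`. -/
theorem Aligned.transpose {X Y W A B : Type*} [Finite X] [Fintype A] [Fintype B]
    [DecidableEq A] [DecidableEq B] {Ψ : X → Y → Matrix A B ℂ} {S : Set X} {T : Set Y}
    (hΨ : Aligned Ψ S T) {h : X → Y → W} (hS : RowConnected h S T)
    (hred : ∀ x x' y, h x y = h x' y → (Ψ x y)ᵀ * (Ψ x y)ᵀᴴ = (Ψ x' y)ᵀ * (Ψ x' y)ᵀᴴ) :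
    Aligned (fun y x => (Ψ x y)ᵀ) T S := by
  classical
  have := Fintype.ofFinite X
  have key := hS.rel (fun x (y y' : T) => (Ψ x y)ᵀ * (Ψ x y')ᵀᴴ) fun x hx x' hx' y₀ hy₀ hxx => by
    have hV : ∀ y : T, ∃ V : Matrix B B ℂ, ∀ x ∈ S, Ψ x y = Ψ x y₀ * V := fun y => by
      -- Stacking the states of all rows into one matrix makes a single `V` serve every `x ∈ S`.
      obtain ⟨V, hV⟩ := exists_eq_mul_of_mul_conjTranspose_eq
        (M := Matrix.of fun (i : S × A) b => Ψ i.1 y i.2 b)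
        (N := Matrix.of fun (i : S × A) b => Ψ i.1 y₀ i.2 b) (by
          ext i j
          exact congrFun₂ (hΨ i.1 i.1.2 j.1 j.1.2 y y.2 y₀ hy₀) i.2 j.2)
      exact ⟨V, fun x hx => Matrix.ext fun a b => congrFun₂ hV (⟨x, hx⟩, a) b⟩
    choose V hV using hV
    funext y y'
    simp only [hV y x hx, hV y x' hx', hV y' x hx, hV y' x' hx', Matrix.transpose_mul,
      Matrix.conjTranspose_mul]
    rw [Matrix.mul_assoc, ← Matrix.mul_assoc _ _ (V y')ᵀᴴ, hred x x' y₀ hxx]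
    simp only [Matrix.mul_assoc]
  exact fun y hy y' hy' x hx x' hx' => congrFun₂ (key x hx x' hx') ⟨y, hy⟩ ⟨y', hy'⟩

/-- The splitting of a register of `a` qubits into two parts. -/
def splitEquiv {a m k : ℕ} (e : Fin a ≃ Fin m ⊕ Fin k) :
    (Fin m → Bool) × (Fin k → Bool) ≃ (Fin a → Bool) :=
  (Equiv.sumArrowEquivProdArrow _ _ _).symm.trans (e.arrowCongr (Equiv.refl Bool)).symm

/-- Handing qubits over means that they, too, are traced out of Al's Gram matrix. -/
theorem sendAl_mul_conjTranspose {a b m k : ℕ} (e : Fin a ≃ Fin m ⊕ Fin k) (ψ φ : QState a b) :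
    Matrix.of (sendAl e ψ) * (Matrix.of (sendAl e φ))ᴴ = Matrix.of fun α α' =>
      ∑ γ, (Matrix.of ψ * (Matrix.of φ)ᴴ) (splitEquiv e (γ, α)) (splitEquiv e (γ, α')) := by
  ext α α'
  simp only [Matrix.mul_apply, Matrix.conjTranspose_apply, Matrix.of_apply]
  rw [← (Fin.appendEquiv m b).sum_comp, Fintype.sum_prod_type]
  refine Finset.sum_congr rfl fun γ _ => Finset.sum_congr rfl fun β _ => ?_
  have h1 : ∀ α, (fun i => Sum.elim (fun j => Fin.append γ β (Fin.castAdd b j)) α (e i)) =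
      splitEquiv e (γ, α) := fun α => by
    funext i
    simp only [Fin.append_left]
    rfl
  have h2 : (fun j => Fin.append γ β (Fin.natAdd m j)) = β := by
    funext j
    simp
  simp only [sendAl, Fin.appendEquiv, Equiv.coe_fn_mk, h1, h2]

theorem applyAl_eq_mul {a b : ℕ} (U : QUnitary a) (ψ : QState a b) :
    Matrix.of (applyAl U ψ) = U.1 * Matrix.of ψ :=
  rfl

/-- Al's round conjugates the Gram matrix by unitaries depending on `x`, `x'` only and takes a
partial trace; neither operation involves `y`. -/
theorem Aligned.round {X Y : Type*} {a b m k : ℕ} {Ψ : X → Y → QState a b} {S : Set X} {T : Set Y}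
    (hΨ : Aligned (fun x y => Matrix.of (Ψ x y)) S T) (U : X → QUnitary a)
    (e : Fin a ≃ Fin m ⊕ Fin k) :
    Aligned (fun x y => Matrix.of (sendAl e (applyAl (U x) (Ψ x y)))) S T := by
  intro x hx x' hx' y hy y' hy'
  have hU : ∀ y, Matrix.of (applyAl (U x) (Ψ x y)) * (Matrix.of (applyAl (U x') (Ψ x' y)))ᴴ =
      (U x).1 * (Matrix.of (Ψ x y) * (Matrix.of (Ψ x' y))ᴴ) * (U x').1ᴴ := fun y => by
    simp only [applyAl_eq_mul, Matrix.conjTranspose_mul, Matrix.mul_assoc]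
  have := hΨ x hx x' hx' y hy y' hy'
  simp only [sendAl_mul_conjTranspose, hU] at this ⊢
  rw [this]

theorem trace_round {a b m k : ℕ} (ψ : QState a b) (U : QUnitary a) (e : Fin a ≃ Fin m ⊕ Fin k) :
    (Matrix.of (sendAl e (applyAl U ψ)) * (Matrix.of (sendAl e (applyAl U ψ)))ᴴ).trace =
      (Matrix.of ψ * (Matrix.of ψ)ᴴ).trace := by
  have h1 : (Matrix.of (applyAl U ψ) * (Matrix.of (applyAl U ψ))ᴴ).trace =
      (Matrix.of ψ * (Matrix.of ψ)ᴴ).trace := by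
    rw [applyAl_eq_mul, Matrix.conjTranspose_mul, Matrix.mul_assoc, Matrix.trace_mul_comm,
      Matrix.mul_assoc, Matrix.mul_assoc, ← Matrix.star_eq_conjTranspose U.1,
      Matrix.UnitaryGroup.star_mul_self, Matrix.mul_one]
  rw [← h1, sendAl_mul_conjTranspose, Matrix.trace, Matrix.trace,
    ← (splitEquiv e).sum_comp, Fintype.sum_prod_type_right]
  rfl

theorem trace_transpose_mul_conjTranspose {A B : Type*} [Fintype A] [Fintype B]
    (M : Matrix A B ℂ) : (Mᵀ * Mᵀᴴ).trace = (M * Mᴴ).trace := by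
  simp only [Matrix.trace, Matrix.diag_apply, Matrix.mul_apply, Matrix.conjTranspose_apply,
    Matrix.transpose_apply]
  exact Finset.sum_comm

variable {X Y W : Type*} [Fintype X] [Fintype Y] [Fintype W] [DecidableEq X] [DecidableEq Y]
  [DecidableEq W]

theorem reduced_eq_of_qDivulged_le {a b : ℕ} {Ψ : X → Y → QState a b} {h : X → Y → W}
    (hnorm : ∀ x y, (Matrix.of (Ψ x y) * (Matrix.of (Ψ x y))ᴴ).trace = 1)
    (hloss : qDivulged Ψ h ≤ 0) :
    (∀ x x' y, h x y = h x' y → reducedBob (Ψ x y) = reducedBob (Ψ x' y)) ∧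
      ∀ y y' x, h x y = h x y' → reducedAl (Ψ x y) = reducedAl (Ψ x y') := by
  have hle := iSup_le_iff.1 hloss
  constructor
  · intro x x' y hxy
    refine eq_of_qCondMutualInfo_nonpos (σ := fun x y => reducedBob (Ψ x y))
      (fun x y => Matrix.posSemidef_self_mul_conjTranspose (Matrix.of (Ψ x y))ᵀ)
      (fun x y => (trace_transpose_mul_conjTranspose _).trans (hnorm x y)) (h := h) ?_ hxy
    intro μ h0 h1
    have := le_trans (le_max_left _ _) (hle ⟨fun p => μ p.1 p.2, fun p => h0 _ _, by
      rw [Fintype.sum_prod_type]; exact h1⟩)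
    exact_mod_cast this
  · intro y y' x hxy
    refine eq_of_qCondMutualInfo_nonpos (σ := fun y x => reducedAl (Ψ x y))
      (fun y x => Matrix.posSemidef_self_mul_conjTranspose (Matrix.of (Ψ x y)))
      (fun y x => hnorm x y) (h := fun y x => h x y) ?_ hxy
    intro μ h0 h1
    have := le_trans (le_max_right _ _) (hle ⟨fun p => μ p.2 p.1, fun p => h0 _ _, by
      rw [Fintype.sum_prod_type_right]; exact h1⟩)
    exact_mod_cast this

/-- Two values that are each taken with probability more than `1 / 2` agree. -/
theorem eq_of_half_lt {A V : Type*} [Fintype A] [DecidableEq V] {p : A → ℝ} (hp : ∀ a, 0 ≤ p a)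
    (hsum : ∑ a, p a = 1) (out : A → V) {z z' : V}
    (hz : 1 / 2 < ∑ a, if out a = z then p a else 0)
    (hz' : 1 / 2 < ∑ a, if out a = z' then p a else 0) : z = z' := by
  by_contra hne
  have : ∑ a, ((if out a = z then p a else 0) + if out a = z' then p a else 0) ≤ ∑ a, p a := by
    refine Finset.sum_le_sum fun a _ => ?_
    by_cases h1 : out a = z
    · simp [h1, hne]
    · rw [if_neg h1, zero_add]
      split_ifs
      exacts [le_rfl, hp a]
  rw [Finset.sum_add_distrib] at this
  linarith

theorem mul_conjTranspose_apply_self {A B : Type*} [Fintype B] (M : Matrix A B ℂ) (i : A) :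
    (M * Mᴴ) i i = ((∑ j, ‖M i j‖ ^ 2 : ℝ) : ℂ) := by
  simp only [Matrix.mul_apply, Matrix.conjTranspose_apply]
  push_cast
  exact Finset.sum_congr rfl fun j _ => Complex.mul_conj' _

/-- If the reduced states of one player agree then so do his probable outputs. -/
theorem eq_of_probable_outputs {A B V : Type*} [Fintype A] [Fintype B] [DecidableEq V]
    {M N : Matrix A B ℂ} (hMN : M * Mᴴ = N * Nᴴ) (hM : (M * Mᴴ).trace = 1) (out : A → V)
    {z z' : V} (q q' : B → Prop) [DecidablePred q] [DecidablePred q']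
    (hz : 1 / 2 < ∑ a, ∑ b, if out a = z ∧ q b then ‖M a b‖ ^ 2 else 0)
    (hz' : 1 / 2 < ∑ a, ∑ b, if out a = z' ∧ q' b then ‖N a b‖ ^ 2 else 0) : z = z' := by
  have hdiag : ∀ i, ∑ j, ‖M i j‖ ^ 2 = ∑ j, ‖N i j‖ ^ 2 := fun i => by
    have := congrFun₂ hMN i i
    rw [mul_conjTranspose_apply_self, mul_conjTranspose_apply_self] at this
    exact_mod_cast this
  have mono : ∀ (K : Matrix A B ℂ) (z : V) (q : B → Prop) [DecidablePred q],
      (∑ a, ∑ b, if out a = z ∧ q b then ‖K a b‖ ^ 2 else 0) ≤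
        ∑ a, if out a = z then ∑ b, ‖K a b‖ ^ 2 else 0 := fun K z q _ => by
    refine Finset.sum_le_sum fun a _ => ?_
    split_ifs with h
    · refine Finset.sum_le_sum fun b _ => ?_
      split_ifs
      exacts [le_rfl, by positivity]
    · simp [h]
  refine eq_of_half_lt (p := fun a => ∑ b, ‖M a b‖ ^ 2) (fun a => by positivity) ?_ out
    (hz.trans_le (mono M z q)) ?_
  · rw [Matrix.trace] at hM
    simp only [Matrix.diag_apply, mul_conjTranspose_apply_self] at hM
    exact_mod_cast hM
  · simp only [hdiag]
    exact hz'.trans_le (mono N z' q')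

/-- Induction over rounds with both alignments as invariant. The sender's alignment passes through
his round automatically; the receiver's is rebuilt from privacy just after the message by
`Aligned.transpose`. -/
theorem QuantumRounds.eq_on_rectangle {h : X → Y → W} {S : Set X} {T : Set Y}
    (hS : RowConnected h S T) (hT : RowConnected (fun y x => h x y) T S) {a b : ℕ}
    (R : QuantumRounds X Y W a b) (Ψ : X → Y → QState a b)
    (hnorm : ∀ x y, (Matrix.of (Ψ x y) * (Matrix.of (Ψ x y))ᴴ).trace = 1)
    (hloss : R.lossFrom h Ψ ≤ 0)
    (hA : Aligned (fun x y => Matrix.of (Ψ x y)) S T)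
    (hB : Aligned (fun y x => (Matrix.of (Ψ x y))ᵀ) T S)
    (hsucc : ∀ x y, 1 / 2 < R.successProb x y (h x y) (Ψ x y)) :
    ∀ x ∈ S, ∀ y ∈ T, ∀ x' ∈ S, ∀ y' ∈ T, h x y = h x' y' := by
  induction R with
  | output outA outB =>
    simp only [QuantumRounds.successProb] at hsucc
    intro x hx y hy x' hx' y' hy'
    -- Alignment with both rows equal to `x` says that Al's reduced state is the same for `y` and
    -- `y'`.
    have h1 : h x y = h x y' := eq_of_probable_outputs (hA x hx x hx y hy y' hy') (hnorm x y)
      (outA x) (fun β => outB y β = h x y) (fun β => outB y' β = h x y') (hsucc x y) (hsucc x y')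
    have h2 : h x y' = h x' y' := by
      refine eq_of_probable_outputs (hB y' hy' y' hy' x hx x' hx')
        ((trace_transpose_mul_conjTranspose _).trans (hnorm x y'))
        (outB y') (fun α => outA x α = h x y') (fun α => outA x' α = h x' y') ?_ ?_
      · have := hsucc x y'
        rw [Finset.sum_comm] at this
        simpa only [and_comm, Matrix.transpose_apply, Matrix.of_apply] using this
      · have := hsucc x' y'
        rw [Finset.sum_comm] at this
        simpa only [and_comm, Matrix.transpose_apply, Matrix.of_apply] using this
    exact h1.trans h2
  | al U e next ih =>
    have hn := fun x y => (trace_round (Ψ x y) (U x) e).trans (hnorm x y)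
    have hA' := hA.round U e
    have hl : next.lossFrom h (fun x y => sendAl e (applyAl (U x) (Ψ x y))) ≤ 0 :=
      (le_max_right _ _).trans hloss
    have hq : qDivulged (fun x y => sendAl e (applyAl (U x) (Ψ x y))) h ≤ 0 := by
      -- Whatever comes next, its loss includes the information divulged at its starting time.
      cases next with
      | output => exact hl
      | al => exact (le_max_left _ _).trans hl
      | bob => exact (le_max_left _ _).trans hl
    exact ih _ hn hl hA' (hA'.transpose hS (reduced_eq_of_qDivulged_le hn hq).1) hsucc
  | bob U e next ih =>
    have hn := fun x y => (trace_transpose_mul_conjTranspose _).symm.trans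
      ((trace_round (fun β α => Ψ x y α β) (U y) e).trans
        ((trace_transpose_mul_conjTranspose _).trans (hnorm x y)))
    have hB' := Aligned.round (Ψ := fun y x β α => Ψ x y α β) hB U e
    have hl : next.lossFrom h (fun x y => sendBob e (applyBob (U y) (Ψ x y))) ≤ 0 :=
      (le_max_right _ _).trans hloss
    have hq : qDivulged (fun x y => sendBob e (applyBob (U y) (Ψ x y))) h ≤ 0 := by
      cases next with
      | output => exact hl
      | al => exact (le_max_left _ _).trans hl
      | bob => exact (le_max_left _ _).trans hl
    exact ih _ hn hl (hB'.transpose hT (reduced_eq_of_qDivulged_le hn hq).2) hB' hsucc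

theorem QuantumProtocol.noForbidden {ε : ℝ} (hε : ε < 1 / 2) (P : QuantumProtocol X Y W)
    {h : X → Y → W} (hP : P.Computes ε h) (hloss : P.privacyLoss h = 0) : NoForbidden h :=
  fun S T hS hT => P.rounds.eq_on_rectangle hS hT (fun _ _ => initialState P.a P.b)
    (fun _ _ => by
      simp only [Matrix.trace, Matrix.diag_apply, mul_conjTranspose_apply_self]
      norm_cast
      rw [Finset.sum_eq_single fun _ => false, Finset.sum_eq_single fun _ => false]
      all_goals simp +contextual [initialState])
    hloss.le (fun _ _ _ _ _ _ _ _ => rfl) (fun _ _ _ _ _ _ _ _ => rfl)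
    fun x y => by linarith [hP x y]

end QuantumLower

/-! ## Quantum protocols for decomposable functions -/

section QuantumUpper

/-- The computational basis state `|α⟩|β⟩`. -/
def basisState {a b : ℕ} (α : Fin a → Bool) (β : Fin b → Bool) : QState a b :=
  fun α' β' => if α' = α ∧ β' = β then 1 else 0

/-- The unitary operator permuting the computational basis. -/
def permUnitary {n : ℕ} (π : Equiv.Perm (Fin n → Bool)) : QUnitary n :=
  ⟨Matrix.of fun i j => if i = π j then 1 else 0, by
    rw [Matrix.mem_unitaryGroup_iff]
    ext i j
    rw [Matrix.mul_apply, ← π.symm.sum_comp]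
    simp [Matrix.star_apply, Matrix.one_apply]⟩

theorem applyAl_permUnitary {a b : ℕ} (π : Equiv.Perm (Fin a → Bool)) (α : Fin a → Bool)
    (β : Fin b → Bool) : applyAl (permUnitary π) (basisState α β) = basisState (π α) β := by
  funext α' β'
  rw [applyAl, Finset.sum_eq_single α]
  · simp [permUnitary, basisState, ite_and]
    split_ifs <;> rfl
  · intro γ _ hγ
    simp [basisState, hγ]
  · simp

theorem applyBob_permUnitary {a b : ℕ} (π : Equiv.Perm (Fin b → Bool)) (α : Fin a → Bool)
    (β : Fin b → Bool) : applyBob (permUnitary π) (basisState α β) = basisState α (π β) := by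
  funext α' β'
  rw [applyBob, Finset.sum_eq_single β]
  · simp [permUnitary, basisState, ite_and, and_comm]
  · intro γ _ hγ
    simp [basisState, hγ]
  · simp

theorem send_iff {a b k m : ℕ} (e : Fin a ≃ Fin m ⊕ Fin k) (α : Fin a → Bool) (β : Fin b → Bool)
    (α' : Fin k → Bool) (β' : Fin (m + b) → Bool) :
    ((fun i => Sum.elim (fun j => β' (Fin.castAdd b j)) α' (e i)) = α ∧
      (fun j => β' (Fin.natAdd m j)) = β) ↔
    α' = (fun j => α (e.symm (Sum.inr j))) ∧
      β' = Fin.append (fun j => α (e.symm (Sum.inl j))) β := by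
  constructor
  · rintro ⟨rfl, rfl⟩
    refine ⟨by funext j; simp, ?_⟩
    funext j
    refine Fin.addCases (fun i => ?_) (fun i => ?_) j <;> simp
  · rintro ⟨rfl, rfl⟩
    refine ⟨funext fun i => ?_, by funext j; simp⟩
    obtain ⟨s, rfl⟩ := e.symm.surjective i
    cases s <;> simp

theorem sendAl_basisState {a b k m : ℕ} (e : Fin a ≃ Fin m ⊕ Fin k) (α : Fin a → Bool)
    (β : Fin b → Bool) : sendAl e (basisState α β) =
      basisState (fun j => α (e.symm (Sum.inr j)))
        (Fin.append (fun j => α (e.symm (Sum.inl j))) β) := by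
  funext α' β'
  simp only [sendAl, basisState, send_iff]

theorem sendBob_basisState {a b k m : ℕ} (e : Fin b ≃ Fin m ⊕ Fin k) (α : Fin a → Bool)
    (β : Fin b → Bool) : sendBob e (basisState α β) =
      basisState (Fin.append (fun j => β (e.symm (Sum.inl j))) α)
        (fun j => β (e.symm (Sum.inr j))) := by
  funext α' β'
  simp only [sendBob, basisState, and_comm (b := _ = β), send_iff]
  simp only [and_comm]

theorem reducedBob_basisState {a b : ℕ} (α : Fin a → Bool) (β : Fin b → Bool) :
    reducedBob (basisState α β) =
      Matrix.diagonal fun b => ((if b = β then 1 else 0 : ℝ) : ℂ) := by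
  ext i j
  rw [reducedBob, Finset.sum_eq_single α]
  · by_cases hij : i = j
    · subst hij
      by_cases hi : i = β <;> simp [basisState, hi]
    · by_cases hi : i = β
      · subst hi
        simp [basisState, hij, Ne.symm hij]
      · simp [basisState, hij, hi]
  · intro γ _ hγ
    simp [basisState, hγ]
  · simp

theorem reducedAl_basisState {a b : ℕ} (α : Fin a → Bool) (β : Fin b → Bool) :
    reducedAl (basisState α β) =
      Matrix.diagonal fun a => ((if a = α then 1 else 0 : ℝ) : ℂ) := by
  rw [← reducedBob_basisState β α]
  funext i j
  simp only [reducedAl, reducedBob, basisState, and_comm]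

/-- The reversible operation that toggles bit `i` by a function of the other bits. -/
def togglePerm {N : ℕ} (i : Fin N) (g : (Fin N → Bool) → Bool) : Equiv.Perm (Fin N → Bool) :=
  Function.Involutive.toPerm
    (fun τ => Function.update τ i (xor (τ i) (g (Function.update τ i false)))) fun τ => by
      simp

theorem togglePerm_apply {N : ℕ} {i : Fin N} {g : (Fin N → Bool) → Bool} {τ : Fin N → Bool}
    (hτ : τ i = false) : togglePerm i g τ = Function.update τ i (g τ) := by
  have : Function.update τ i false = τ := by rw [← hτ, Function.update_eq_self]
  change Function.update τ i (xor (τ i) (g (Function.update τ i false))) = _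
  rw [hτ, this, Bool.false_xor]

/-- A permutation of the basis of a pair of registers. -/
def pairPerm {M N : ℕ} (π : Equiv.Perm ((Fin M → Bool) × (Fin N → Bool))) :
    Equiv.Perm (Fin (M + N) → Bool) :=
  (Fin.appendEquiv M N).permCongr π

theorem pairPerm_append {M N : ℕ} (π : Equiv.Perm ((Fin M → Bool) × (Fin N → Bool)))
    (τ : Fin M → Bool) (σ : Fin N → Bool) :
    pairPerm π (Fin.append τ σ) = Fin.append (π (τ, σ)).1 (π (τ, σ)).2 := by
  have : Fin.append τ σ = Fin.appendEquiv M N (τ, σ) := rfl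
  rw [this, pairPerm, Equiv.permCongr_apply, Equiv.symm_apply_apply]
  rfl

/-- The operation `|τ⟩|σ⟩ ↦ |τ⟩|σ ⊕ τ⟩`. -/
def copyPerm (N : ℕ) : Equiv.Perm ((Fin N → Bool) × (Fin N → Bool)) :=
  Function.Involutive.toPerm (fun p => (p.1, fun i => xor (p.2 i) (p.1 i))) fun p => by simp

theorem append_fin_zero {N : ℕ} (τ : Fin N → Bool) (σ : Fin 0 → Bool) : Fin.append τ σ = τ := by
  rw [Fin.append_right_nil _ _ rfl]
  rfl

theorem sendBob_exchange {N : ℕ} (ρ : Equiv.Perm ((Fin N → Bool) × (Fin N → Bool)))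
    (α : Fin 0 → Bool) (τ σ : Fin N → Bool) :
    sendBob finSumFinEquiv.symm (applyBob (permUnitary (pairPerm ρ))
      (basisState α (Fin.append τ σ))) = basisState (ρ (τ, σ)).1 (ρ (τ, σ)).2 := by
  rw [applyBob_permUnitary, sendBob_basisState, pairPerm_append]
  simp only [Equiv.symm_symm, finSumFinEquiv_apply_left, finSumFinEquiv_apply_right,
    Fin.append_left, Fin.append_right, append_fin_zero]

theorem sendAl_exchange {N : ℕ} (π : Equiv.Perm (Fin N → Bool)) (τ σ : Fin N → Bool) :
    sendAl (k := 0) (Equiv.sumEmpty _ _).symm (applyAl (permUnitary π) (basisState τ σ)) =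
      basisState (fun j => j.elim0) (Fin.append (π τ) σ) := by
  rw [applyAl_permUnitary, sendAl_basisState]
  congr 1
  funext j
  exact j.elim0

variable {X Y W : Type*} [DecidableEq W]

/-- Al applies `π` and hands his whole register over to Bob, who applies `ρ` and returns the first
half of his qubits. -/
def exchangeRounds {N : ℕ} (π : X → Equiv.Perm (Fin N → Bool))
    (ρ : Y → Equiv.Perm ((Fin N → Bool) × (Fin N → Bool))) (next : QuantumRounds X Y W N N) :
    QuantumRounds X Y W N N :=
  .al (k := 0) (fun x => permUnitary (π x)) (Equiv.sumEmpty _ _).symm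
    (.bob (fun y => permUnitary (pairPerm (ρ y))) finSumFinEquiv.symm next)

theorem successProb_exchange {N : ℕ} (π : X → Equiv.Perm (Fin N → Bool))
    (ρ : Y → Equiv.Perm ((Fin N → Bool) × (Fin N → Bool))) (next : QuantumRounds X Y W N N)
    (x : X) (y : Y) (z : W) (τ σ : Fin N → Bool) :
    (exchangeRounds π ρ next).successProb x y z (basisState τ σ) =
      next.successProb x y z (basisState (ρ y (π x τ, σ)).1 (ρ y (π x τ, σ)).2) := by
  simp only [exchangeRounds, QuantumRounds.successProb, sendAl_exchange, sendBob_exchange]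

variable [Fintype X] [Fintype Y] [Fintype W] [DecidableEq X] [DecidableEq Y] [Nonempty X]
  [Nonempty Y]

theorem qDivulged_basisState {a b : ℕ} (α : X → Y → Fin a → Bool) (β : X → Y → Fin b → Bool)
    {h : X → Y → W} (hα : ∀ x y y', h x y = h x y' → α x y = α x y')
    (hβ : ∀ x x' y, h x y = h x' y → β x y = β x' y) :
    qDivulged (fun x y => basisState (α x y) (β x y)) h = 0 := by
  have : ∀ μ : stdSimplex ℝ (X × Y),
      max (qDivulgedToBob (fun x y => basisState (α x y) (β x y)) h μ : EReal)
        (qDivulgedToAl (fun x y => basisState (α x y) (β x y)) h μ : EReal) = 0 := fun μ => by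
    simp only [qDivulgedToBob, qDivulgedToAl, reducedBob_basisState, reducedAl_basisState]
    rw [qCondMutualInfo_cqState_eq_zero β h hβ,
      qCondMutualInfo_cqState_eq_zero (fun y x => α x y) (fun y x => h x y)
        fun y y' x => hα x y y']
    simp
  rw [qDivulged]
  simp only [this]
  -- The simplex is nonempty because `X` and `Y` are; an empty supremum would be `⊥` instead of 0.
  exact ciSup_const

/-- The intermediate time, when Bob owns every qubit, accounts for `hπ`: what Al has just written
must be determined by `(y, h x y)`. -/
theorem lossFrom_exchange {N : ℕ} (π : X → Equiv.Perm (Fin N → Bool))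
    (ρ : Y → Equiv.Perm ((Fin N → Bool) × (Fin N → Bool))) (next : QuantumRounds X Y W N N)
    {h : X → Y → W} {τ σ : X → Y → Fin N → Bool}
    (hτ : ∀ x y y', h x y = h x y' → τ x y = τ x y')
    (hσ : ∀ x x' y, h x y = h x' y → σ x y = σ x' y)
    (hπ : ∀ x x' y, h x y = h x' y → π x (τ x y) = π x' (τ x' y))
    (hnext : next.lossFrom h (fun x y =>
      basisState (ρ y (π x (τ x y), σ x y)).1 (ρ y (π x (τ x y), σ x y)).2) = 0) :
    (exchangeRounds π ρ next).lossFrom h (fun x y => basisState (τ x y) (σ x y)) = 0 := by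
  simp only [exchangeRounds, QuantumRounds.lossFrom, sendAl_exchange, sendBob_exchange]
  rw [qDivulged_basisState τ σ hτ hσ,
    qDivulged_basisState (fun _ _ j => j.elim0)
      (fun x y => Fin.append (π x (τ x y)) (σ x y)) (fun _ _ _ _ => rfl)
      (fun x x' y hxx => by rw [hπ x x' y hxx, hσ x x' y hxx]), hnext, max_self, max_self]

/-- The register `k x y` holds the `n` bits announced so far, followed by zeros. It travels back and
forth whole, while Bob's own register stays zero. Each of the `m` remaining rounds writes two bits,
and `S τ × T τ` is the rectangle attached to transcript `τ`. Privacy amounts to `hA` and `hB`. -/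
theorem Decomposable.exists_quantumRounds {h : X → Y → W} {N : ℕ} (m n : ℕ) (hmn : n + 2 * m ≤ N)
    (S : (Fin N → Bool) → Set X) (T : (Fin N → Bool) → Set Y)
    (hD : ∀ τ, Decomposable h m (S τ) (T τ)) (k : X → Y → Fin N → Bool)
    (hS : ∀ x y, x ∈ S (k x y)) (hT : ∀ x y, y ∈ T (k x y))
    (hk : ∀ x y j, n ≤ j.1 → k x y j = false)
    (hA : ∀ x y y', h x y = h x y' → k x y = k x y')
    (hB : ∀ x x' y, h x y = h x' y → k x y = k x' y) :
    ∃ R : QuantumRounds X Y W N N,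
      (∀ x y, R.successProb x y (h x y) (basisState (k x y) fun _ => false) = 1) ∧
      R.lossFrom h (fun x y => basisState (k x y) fun _ => false) = 0 := by
  induction m generalizing n S T k with
  | zero =>
    choose w hw using hD
    have hval : ∀ x y, w (k x y) = h x y := fun x y => (hw _ x (hS x y) y (hT x y)).symm
    have hcopy : ∀ τ : Fin N → Bool, copyPerm N (τ, fun _ => false) = (τ, τ) := fun τ => by
      change (τ, fun i => xor false (τ i)) = _
      simp only [Bool.false_xor]
    -- A last exchange copies the transcript into Bob's register, so that both players read off the
    -- value.
    refine ⟨exchangeRounds (fun _ => 1) (fun _ => copyPerm N)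
      (.output (fun _ => w) fun _ => w), fun x y => ?_, ?_⟩
    · rw [successProb_exchange, Equiv.Perm.one_apply, hcopy, QuantumRounds.successProb,
        Finset.sum_eq_single (k x y), Finset.sum_eq_single (k x y)]
      all_goals simp +contextual [basisState, hval]
    · refine lossFrom_exchange _ _ _ hA (fun _ _ _ _ => rfl) hB ?_
      simp only [Equiv.Perm.one_apply, hcopy]
      exact qDivulged_basisState _ _ hA hB
  | succ m ih =>
    choose c hc d hd hD using hD
    obtain ⟨i, hi⟩ : ∃ i : Fin N, i.1 = n := ⟨⟨n, by omega⟩, rfl⟩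
    obtain ⟨j, hj⟩ : ∃ j : Fin N, j.1 = n + 1 := ⟨⟨n + 1, by omega⟩, rfl⟩
    have hij : i ≠ j := fun h => by rw [h] at hi; omega
    set k₁ : X → Y → Fin N → Bool := fun x y => Function.update (k x y) i (c (k x y) x) with hk₁
    set k₂ : X → Y → Fin N → Bool := fun x y =>
      Function.update (k₁ x y) j (d (k x y) (c (k x y) x) y) with hk₂
    -- Clearing the two new bits recovers the earlier transcript, by which the current rectangles
    -- and splits are indexed.
    set base : (Fin N → Bool) → Fin N → Bool := fun τ =>
      Function.update (Function.update τ j false) i false with hbase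
    have hki : ∀ x y, k x y i = false := fun x y => hk x y i (by omega)
    have hkj : ∀ x y, k x y j = false := fun x y => hk x y j (by omega)
    have hb₁ : ∀ x y, Function.update (k₁ x y) i false = k x y := fun x y => by
      rw [hk₁, Function.update_idem, ← hki x y, Function.update_eq_self]
    have hb₂ : ∀ x y, base (k₂ x y) = k x y := fun x y => by
      funext l
      by_cases hli : l = i
      · simp [hbase, hli, hki]
      · by_cases hlj : l = j
        · simp [hbase, hlj, hij.symm, hkj]
        · simp [hbase, hk₂, hk₁, hli, hlj]
    have hki₁ : ∀ x y, k₁ x y i = c (k x y) x := fun x y => by simp [hk₁]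
    have hki₂ : ∀ x y, k₂ x y i = c (k x y) x := fun x y => by simp [hk₂, hij, hki₁]
    have hkj₂ : ∀ x y, k₂ x y j = d (k x y) (c (k x y) x) y := fun x y => by simp [hk₂]
    have hcB : ∀ x x' y, h x y = h x' y → c (k x y) x = c (k x' y) x' := fun x x' y hxx => by
      have := hS x' y
      rw [← hB x x' y hxx] at this ⊢
      exact hc _ x (hS x y) x' this y (hT x y) hxx
    have hA₁ : ∀ x y y', h x y = h x y' → k₁ x y = k₁ x y' := fun x y y' hyy => by
      simp only [hk₁, hA x y y' hyy]
    have hB₁ : ∀ x x' y, h x y = h x' y → k₁ x y = k₁ x' y := fun x x' y hxx => by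
      simp only [hk₁]
      rw [hcB x x' y hxx, hB x x' y hxx]
    have hA₂ : ∀ x y y', h x y = h x y' → k₂ x y = k₂ x y' := fun x y y' hyy => by
      have := hT x y'
      simp only [hk₂]
      rw [← hA₁ x y y' hyy]
      rw [← hA x y y' hyy] at this ⊢
      rw [hd (k x y) (c (k x y) x) y (hT x y) y' this x ⟨hS x y, rfl⟩ hyy]
    have hB₂ : ∀ x x' y, h x y = h x' y → k₂ x y = k₂ x' y := fun x x' y hxx => by
      simp only [hk₂]
      rw [← hB₁ x x' y hxx, ← hcB x x' y hxx, ← hB x x' y hxx]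
    obtain ⟨R, hR, hloss⟩ := ih (n + 2) (by omega)
      (fun τ => {x ∈ S (base τ) | c (base τ) x = τ i})
      (fun τ => {y ∈ T (base τ) | d (base τ) (τ i) y = τ j})
      (fun τ => hD (base τ) (τ i) (τ j)) k₂
      (fun x y => by simp only [hb₂, hki₂]; exact ⟨hS x y, rfl⟩)
      (fun x y => by simp only [hb₂, hki₂, hkj₂]; exact ⟨hT x y, rfl⟩)
      (fun x y l hl => by
        have hli : l ≠ i := fun h => by rw [h] at hl; omega
        have hlj : l ≠ j := fun h => by rw [h] at hl; omega
        simp only [hk₂, hk₁, Function.update_of_ne hli, Function.update_of_ne hlj]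
        exact hk x y l (by omega)) hA₂ hB₂
    set π : X → Equiv.Perm (Fin N → Bool) := fun x => togglePerm i fun τ => c τ x with hπ
    -- Bob reads Al's new bit at `i`, then clears it in the argument, since `d` is indexed by the
    -- transcript before this round.
    set ρ : Y → Equiv.Perm ((Fin N → Bool) × (Fin N → Bool)) := fun y =>
      (togglePerm j fun τ => d (Function.update τ i false) (τ i) y).prodCongr (Equiv.refl _) with hρ
    have hπk : ∀ x y, π x (k x y) = k₁ x y := fun x y => togglePerm_apply (hki x y)
    have hρk : ∀ x y σ, ρ y (k₁ x y, σ) = (k₂ x y, σ) := fun x y σ => by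
      have : togglePerm j (fun τ => d (Function.update τ i false) (τ i) y) (k₁ x y) = k₂ x y := by
        rw [togglePerm_apply (by simp [hk₁, hij.symm, hkj]), hb₁, hki₁]
      simp only [hρ, Equiv.prodCongr_apply, Prod.map, this]
      rfl
    refine ⟨exchangeRounds π ρ R, fun x y => ?_, ?_⟩
    · rw [successProb_exchange, hπk, hρk]
      exact hR x y
    · refine lossFrom_exchange π ρ R hA (fun _ _ _ _ => rfl) (fun x x' y hxx => ?_) ?_
      · rw [hπk, hπk, hB₁ x x' y hxx]
      · simp only [hπk, hρk]
        exact hloss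

theorem Decomposable.quantumPrivate {V : Type} [Fintype V] [DecidableEq V] {h : X → Y → V} {m : ℕ}
    (hD : Decomposable h m Set.univ Set.univ) {ε : ℝ} (hε : 0 ≤ ε) : QuantumPrivate ε h := by
  obtain ⟨R, hR, hloss⟩ := Decomposable.exists_quantumRounds (N := 2 * m) m 0 (by omega)
    (fun _ => Set.univ) (fun _ => Set.univ) (fun _ => hD) (fun _ _ _ => false)
    (fun _ _ => trivial) (fun _ _ => trivial) (fun _ _ _ _ => rfl) (fun _ _ _ _ => rfl)
    (fun _ _ _ _ => rfl)
  refine ⟨⟨_, _, R⟩, fun x y => ?_, hloss⟩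
  have : R.successProb x y (h x y) (initialState (2 * m) (2 * m)) = 1 := hR x y
  linarith

end QuantumUpper

/-! ## Shannon entropy -/

section Shannon

variable {Ω P Q R : Type*} [Fintype Ω] [DecidableEq P] [DecidableEq Q] [DecidableEq R]

theorem shannonEntropy_eq_sum (p : Ω → ℝ) (g : Ω → P) (s : Finset P)
    (hs : ∀ v, v ∉ s → ∑ ω with g ω = v, p ω = 0) :
    shannonEntropy p g = ∑ v ∈ s, Real.negMulLog (∑ ω with g ω = v, p ω) / Real.log 2 := by
  rw [shannonEntropy,
    Finset.sum_subset (Finset.subset_union_left (s₁ := Finset.univ.image g) (s₂ := s)),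
    Finset.sum_subset (Finset.subset_union_right (s₁ := Finset.univ.image g) (s₂ := s))]
  · intro v _ hv
    rw [hs v hv]; simp
  · intro v _ hv
    rw [Finset.sum_filter, Finset.sum_eq_zero]
    · simp
    · intro ω _
      rw [if_neg]
      rintro rfl
      exact hv (Finset.mem_image_of_mem g (Finset.mem_univ ω))

/-- Entropy depends only on the partition into fibres. -/
theorem shannonEntropy_congr (p : Ω → ℝ) (g : Ω → P) (g' : Ω → Q)
    (hg : ∀ ω ω', g ω = g ω' ↔ g' ω = g' ω') : shannonEntropy p g = shannonEntropy p g' := by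
  cases isEmpty_or_nonempty Ω with
  | inl h => simp [shannonEntropy]
  | inr h =>
    have hr : ∀ ω, g' (Function.invFun g (g ω)) = g' ω := fun ω =>
      (hg _ _).1 (Function.invFun_eq ⟨ω, rfl⟩)
    refine Finset.sum_bij (fun v _ => g' (Function.invFun g v)) ?_ ?_ ?_ ?_
    · intro v _
      exact Finset.mem_image_of_mem g' (Finset.mem_univ _)
    · simp only [Finset.mem_image, Finset.mem_univ, true_and, forall_exists_index]
      rintro _ ω rfl _ ω' rfl hv
      rw [hr, hr] at hv
      exact (hg _ _).2 hv
    · simp only [Finset.mem_image, Finset.mem_univ, true_and, forall_exists_index]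
      rintro _ ω rfl
      exact ⟨g ω, ⟨ω, rfl⟩, hr ω⟩
    · simp only [Finset.mem_image, Finset.mem_univ, true_and, forall_exists_index]
      rintro _ ω rfl
      simp only [hr, hg]

theorem condMutualInfo_eq_zero (p : Ω → ℝ) (V : Ω → P) (U : Ω → Q) (Z : Ω → R)
    (hV : ∀ ω ω', Z ω = Z ω' → V ω = V ω') : condMutualInfo p V U Z = 0 := by
  rw [condMutualInfo, shannonEntropy_congr p (fun ω => (V ω, Z ω)) Z,
    shannonEntropy_congr p (fun ω => (V ω, U ω, Z ω)) (fun ω => (U ω, Z ω))]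
  · ring
  · intro ω ω'
    simp only [Prod.mk.injEq]
    exact ⟨fun h => h.2, fun h => ⟨hV _ _ h.2, h⟩⟩
  · intro ω ω'
    simp only [Prod.mk.injEq]
    exact ⟨fun h => h.2, fun h => ⟨hV _ _ h, h⟩⟩

/-- A random variable that carries no information about a fair choice between `u` and `u'` is
equally distributed for `u` and `u'`. -/
theorem sum_eq_of_condMutualInfo_nonpos {p : Ω → ℝ} (hp : ∀ ω, 0 ≤ p ω) (V : Ω → P) (U : Ω → Q)
    (Z : Ω → R) {u u' : Q} (hne : u ≠ u') {z : R}
    (hsupp : ∀ ω, p ω ≠ 0 → Z ω = z ∧ (U ω = u ∨ U ω = u'))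
    (hu : ∑ ω, (if U ω = u then p ω else 0) = 1 / 2)
    (hu' : ∑ ω, (if U ω = u' then p ω else 0) = 1 / 2)
    (hI : condMutualInfo p V U Z ≤ 0) (F : P → ℝ) :
    ∑ ω, (if U ω = u then F (V ω) * p ω else 0) = ∑ ω, if U ω = u' then F (V ω) * p ω else 0 := by
  have hlog : 0 < Real.log 2 := Real.log_pos (by norm_num)
  set m : Q → P → ℝ := fun q v => ∑ ω, if V ω = v ∧ U ω = q then p ω else 0 with hm
  have hm0 : ∀ q v, 0 ≤ m q v := fun q v => Finset.sum_nonneg fun ω _ => by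
    split_ifs; exacts [hp ω, le_rfl]
  set s := Finset.univ.image V with hs
  have hVs : ∀ ω, V ω ∈ s := fun ω => Finset.mem_image_of_mem V (Finset.mem_univ ω)
  have split : ∀ ω, p ω = (if U ω = u then p ω else 0) + if U ω = u' then p ω else 0 := fun ω => by
    by_cases h0 : p ω = 0
    · simp [h0]
    · rcases (hsupp ω h0).2 with h | h <;> simp [h, hne, hne.symm]
  have dist : ∀ q, ∑ v ∈ s, m q v = ∑ ω, if U ω = q then p ω else 0 := fun q => by
    rw [hm, Finset.sum_comm]
    refine Finset.sum_congr rfl fun ω _ => ?_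
    simp [ite_and, hVs]
  have hZ : shannonEntropy p Z = 0 := by
    rw [shannonEntropy_eq_sum p Z {z}, Finset.sum_singleton]
    · have : ∑ ω with Z ω = z, p ω = 1 := by
        rw [Finset.sum_filter, show (1 : ℝ) = 1 / 2 + 1 / 2 by norm_num]
        nth_rewrite 1 [← hu]
        rw [← hu', ← Finset.sum_add_distrib]
        refine Finset.sum_congr rfl fun ω _ => ?_
        rw [← split]
        by_cases h0 : p ω = 0
        · simp [h0]
        · simp [(hsupp ω h0).1]
      rw [this]; simp
    · intro v hv
      rw [Finset.sum_filter]
      refine Finset.sum_eq_zero fun ω _ => ?_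
      by_contra h
      simp only [ite_eq_right_iff, Classical.not_imp] at h
      exact hv (by rw [← h.1, (hsupp ω h.2).1]; simp)
  have hUZ : shannonEntropy p (fun ω => (U ω, Z ω)) = 1 := by
    rw [shannonEntropy_eq_sum p _ ({u, u'} ×ˢ {z}), Finset.sum_product, Finset.sum_pair hne]
    · have : ∀ q, ∑ ω with (U ω, Z ω) = (q, z), p ω = ∑ ω, if U ω = q then p ω else 0 := fun q => by
        rw [Finset.sum_filter]
        refine Finset.sum_congr rfl fun ω _ => ?_
        by_cases h0 : p ω = 0
        · simp [h0]
        · simp [(hsupp ω h0).1]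
      simp only [Finset.sum_singleton, this, hu, hu']
      rw [Real.negMulLog, one_div, Real.log_inv]
      field_simp
      norm_num
    · rintro v hv
      rw [Finset.sum_filter]
      refine Finset.sum_eq_zero fun ω _ => ?_
      by_contra h
      simp only [ite_eq_right_iff, Classical.not_imp] at h
      exact hv (by rw [← h.1]; rcases hsupp ω h.2 with ⟨hz, hU | hU⟩ <;> simp [hz, hU])
  have hVZ : shannonEntropy p (fun ω => (V ω, Z ω)) =
      ∑ v ∈ s, Real.negMulLog (m u v + m u' v) / Real.log 2 := by
    rw [shannonEntropy_eq_sum p _ (s ×ˢ {z}), Finset.sum_product]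
    · refine Finset.sum_congr rfl fun v _ => ?_
      rw [Finset.sum_singleton, Finset.sum_filter, hm, ← Finset.sum_add_distrib]
      congr 2
      refine Finset.sum_congr rfl fun ω _ => ?_
      by_cases h0 : p ω = 0
      · simp [h0]
      · rcases hsupp ω h0 with ⟨hz, h | h⟩ <;> simp [h, hne, hne.symm, hz]
    · rintro v hv
      rw [Finset.sum_filter]
      refine Finset.sum_eq_zero fun ω _ => ?_
      by_contra h
      simp only [ite_eq_right_iff, Classical.not_imp] at h
      exact hv (by rw [← h.1]; simp [hVs, (hsupp ω h.2).1])
  have hVUZ : shannonEntropy p (fun ω => (V ω, U ω, Z ω)) =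
      ∑ v ∈ s, (Real.negMulLog (m u v) / Real.log 2 + Real.negMulLog (m u' v) / Real.log 2) := by
    rw [shannonEntropy_eq_sum p _ (s ×ˢ {u, u'} ×ˢ {z}), Finset.sum_product]
    · refine Finset.sum_congr rfl fun v _ => ?_
      have : ∀ q, ∑ ω with (V ω, U ω, Z ω) = (v, q, z), p ω = m q v := fun q => by
        rw [Finset.sum_filter]
        refine Finset.sum_congr rfl fun ω _ => ?_
        by_cases h0 : p ω = 0
        · simp [h0]
        · simp [(hsupp ω h0).1]
      rw [Finset.sum_product, Finset.sum_pair hne, Finset.sum_singleton, Finset.sum_singleton,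
        this, this]
    · rintro v hv
      rw [Finset.sum_filter]
      refine Finset.sum_eq_zero fun ω _ => ?_
      by_contra h
      simp only [ite_eq_right_iff, Classical.not_imp] at h
      exact hv (by rw [← h.1]; rcases hsupp ω h.2 with ⟨hz, hU | hU⟩ <;> simp [hVs, hz, hU])
  have hterm : ∀ v ∈ s, Real.negMulLog (m u v) + Real.negMulLog (m u' v) ≤
      Real.negMulLog (m u v + m u' v) + (m u v + m u' v) * Real.log 2 := fun v _ =>
    (negMulLog_add_negMulLog_le (hm0 u v) (hm0 u' v)).1
  have htot : ∑ v ∈ s, (m u v + m u' v) = 1 := by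
    rw [Finset.sum_add_distrib, dist, dist, hu, hu']; norm_num
  -- Here `H(Z) = 0` and `H(U,Z) = 1`, so `hI` reverses the sum of the midpoint inequalities
  -- `hterm`; each of them is then an equality.
  have hmm : ∀ v ∈ s, m u v = m u' v := by
    have heq := le_antisymm (Finset.sum_le_sum hterm) (by
      rw [condMutualInfo, hZ, hUZ, hVZ, hVUZ, Finset.sum_add_distrib, ← Finset.sum_div,
        ← Finset.sum_div, ← Finset.sum_div] at hI
      rw [Finset.sum_add_distrib, ← Finset.sum_mul, htot, Finset.sum_add_distrib]
      have := mul_nonpos_of_nonneg_of_nonpos hlog.le hI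
      field_simp at this
      linarith)
    rw [Finset.sum_eq_sum_iff_of_le hterm] at heq
    exact fun v hv => (negMulLog_add_negMulLog_le (hm0 u v) (hm0 u' v)).2 (heq v hv)
  have push : ∀ q, ∑ ω, (if U ω = q then F (V ω) * p ω else 0) = ∑ v ∈ s, F v * m q v := fun q => by
    simp only [hm, Finset.mul_sum]
    rw [Finset.sum_comm]
    refine Finset.sum_congr rfl fun ω _ => ?_
    rw [Finset.sum_eq_single (V ω)]
    · simp
    · intro v _ hv
      simp [hv.symm]
    · exact fun h => (h (hVs ω)).elim
  rw [push, push]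
  exact Finset.sum_congr rfl fun v hv => by rw [hmm v hv]

end Shannon

/-! ## Classical protocols -/

section ClassicalUpper

variable {X Y W : Type*}

/-- Each split is by definition a bit determined by the listener's input and the value of `h`; hence
so is the whole transcript. Coins are ignored, so their types are arbitrary. -/
theorem Decomposable.exists_tree {h : X → Y → W} (RA RB : Type) {n : ℕ} {S : Set X} {T : Set Y}
    (hD : Decomposable h n S T) : ∃ t : ProtocolTree X Y W RA RB,
      (∀ x ∈ S, ∀ y ∈ T, ∀ ra rb, t.outputs x y ra rb = (h x y, h x y)) ∧
      (∀ x ∈ S, ∀ x' ∈ S, ∀ y ∈ T, ∀ ra rb ra' rb', h x y = h x' y →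
        t.transcript x y ra rb = t.transcript x' y ra' rb') ∧
      (∀ x ∈ S, ∀ y ∈ T, ∀ y' ∈ T, ∀ ra rb ra' rb', h x y = h x y' →
        t.transcript x y ra rb = t.transcript x y' ra' rb') := by
  induction n generalizing S T with
  | zero =>
    obtain ⟨w, hw⟩ := hD
    exact ⟨.output (fun _ _ => w) (fun _ _ => w), fun x hx y hy _ _ => by
      rw [hw x hx y hy, ProtocolTree.outputs], fun _ _ _ _ _ _ _ _ _ _ _ => rfl,
      fun _ _ _ _ _ _ _ _ _ _ _ => rfl⟩
  | succ n ih =>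
    obtain ⟨c, hc, hD⟩ := hD
    choose d hd hD using hD
    choose t hout hB hA using fun b b' => ih (hD b b')
    refine ⟨.al (fun x _ => c x) fun b => .bob (fun y _ => d b y) fun b' => t b b', ?_, ?_, ?_⟩
    · intro x hx y hy ra rb
      exact hout _ _ x ⟨hx, rfl⟩ y ⟨hy, rfl⟩ ra rb
    · intro x hx x' hx' y hy ra rb ra' rb' hxx
      have hcx := hc x hx x' hx' y hy hxx
      simp only [ProtocolTree.transcript, hcx]
      rw [hB _ _ x ⟨hx, hcx⟩ x' ⟨hx', rfl⟩ y ⟨hy, rfl⟩ ra rb ra' rb' hxx]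
    · intro x hx y hy y' hy' ra rb ra' rb' hyy
      have hdy := hd (c x) y hy y' hy' x ⟨hx, rfl⟩ hyy
      simp only [ProtocolTree.transcript, hdy]
      rw [hA _ _ x ⟨hx, rfl⟩ y ⟨hy, hdy⟩ y' ⟨hy', rfl⟩ ra rb ra' rb' hyy]

theorem Decomposable.deterministicallyPrivate [Fintype X] [Fintype Y] [DecidableEq X]
    [DecidableEq Y] [Nonempty X] [Nonempty Y] {V : Type} [DecidableEq V] {h : X → Y → V} {n : ℕ}
    (hD : Decomposable h n Set.univ Set.univ) : DeterministicallyPrivate h := by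
  obtain ⟨t, hout, hB, hA⟩ := hD.exists_tree (Fin 1) (Fin 1)
  have hone : ∑ _ : Fin 1, (1 : ℝ) = 1 := by simp
  refine ⟨⟨1, 1, ⟨fun _ => 1, fun _ => zero_le_one, hone⟩, ⟨fun _ => 1, fun _ => zero_le_one, hone⟩,
    t⟩, ⟨rfl, rfl⟩, fun x y => ?_, ?_⟩
  · simp [hout x trivial y trivial]
  · rw [ClassicalProtocol.privacyLoss]
    have hdB := fun (n : ℕ) (μ : stdSimplex ℝ (X × Y)) =>
      condMutualInfo_eq_zero (ClassicalProtocol.joint ⟨1, 1, ⟨fun _ => 1, fun _ => zero_le_one, hone⟩,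
          ⟨fun _ => 1, fun _ => zero_le_one, hone⟩, t⟩ μ)
        (fun ω => (ω.2.2.2, (t.transcript ω.1 ω.2.1 ω.2.2.1 ω.2.2.2).take n))
        (fun ω => ω.1) (fun ω => (ω.2.1, h ω.1 ω.2.1)) (by
          rintro ⟨x, y, ra, rb⟩ ⟨x', y', ra', rb'⟩ hz
          simp only [Prod.mk.injEq] at hz ⊢
          obtain ⟨rfl, hz⟩ := hz
          exact ⟨Subsingleton.elim (α := Fin 1) _ _,
            by rw [hB x trivial x' trivial y trivial ra rb ra' rb' hz]⟩)
    have hdA := fun (n : ℕ) (μ : stdSimplex ℝ (X × Y)) =>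
      condMutualInfo_eq_zero (ClassicalProtocol.joint ⟨1, 1, ⟨fun _ => 1, fun _ => zero_le_one, hone⟩,
          ⟨fun _ => 1, fun _ => zero_le_one, hone⟩, t⟩ μ)
        (fun ω => (ω.2.2.1, (t.transcript ω.1 ω.2.1 ω.2.2.1 ω.2.2.2).take n))
        (fun ω => ω.2.1) (fun ω => (ω.1, h ω.1 ω.2.1)) (by
          rintro ⟨x, y, ra, rb⟩ ⟨x', y', ra', rb'⟩ hz
          simp only [Prod.mk.injEq] at hz ⊢
          obtain ⟨rfl, hz⟩ := hz
          exact ⟨Subsingleton.elim (α := Fin 1) _ _,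
            by rw [hA x trivial y trivial y' trivial ra rb ra' rb' hz]⟩)
    simp only [ClassicalProtocol.divulgedToBob, ClassicalProtocol.divulgedToAl]
    refine (iSup_congr fun n => iSup_congr fun μ => ?_).trans
      ((iSup_congr fun _ : ℕ => ciSup_const (ι := stdSimplex ℝ (X × Y))).trans ciSup_const)
    rw [hdB n μ, hdA n μ]
    simp

end ClassicalUpper

/-! ### From zero loss to invariance of transcript probabilities. -/

section ClassicalLower

variable {X Y W : Type*}

/-- The weight of the coins for which the bits `q` are sent first, when coins are weighted by `a`
and `b`. -/
def ProtocolTree.prefixWeight {RA RB : Type} [Fintype RA] [Fintype RB]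
    (t : ProtocolTree X Y W RA RB) (a : X → RA → ℝ) (b : Y → RB → ℝ) (q : List Bool) (x : X)
    (y : Y) : ℝ :=
  ∑ ra, ∑ rb, if (t.transcript x y ra rb).take q.length = q then a x ra * b y rb else 0

/-- Weighted mean of a function of the outputs. -/
def ProtocolTree.outputMean {RA RB : Type} [Fintype RA] [Fintype RB]
    (t : ProtocolTree X Y W RA RB) (a : X → RA → ℝ) (b : Y → RB → ℝ) (F : W × W → ℝ) (x : X)
    (y : Y) : ℝ :=
  ∑ ra, ∑ rb, F (t.outputs x y ra rb) * (a x ra * b y rb)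

/-- The uniform distribution on two inputs. -/
def twoPoint {α : Type*} [Fintype α] [DecidableEq α] (i j : α) (hij : i ≠ j) : stdSimplex ℝ α :=
  ⟨fun k => if k = i ∨ k = j then 1 / 2 else 0, fun k => by dsimp only; split_ifs <;> norm_num, by
    rw [Fintype.sum_eq_add i j hij fun k hk => by simp [hk.1, hk.2]]
    norm_num⟩

theorem ClassicalProtocol.sum_coins (P : ClassicalProtocol X Y W) :
    ∑ ra, ∑ rb, P.pA.1 ra * P.pB.1 rb = 1 := by
  rw [← Finset.sum_mul_sum, P.pA.2.2, P.pB.2.2, one_mul]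

theorem ClassicalProtocol.sum_joint [Fintype X] [Fintype Y] (P : ClassicalProtocol X Y W) (μ : stdSimplex ℝ (X × Y))
    (G : X × Y × Fin P.rA × Fin P.rB → ℝ) :
    ∑ ω, G ω * P.joint μ ω = ∑ x, ∑ y, μ.1 (x, y) *
      ∑ ra, ∑ rb, G (x, y, ra, rb) * (P.pA.1 ra * P.pB.1 rb) := by
  simp only [Fintype.sum_prod_type, Finset.mul_sum, ClassicalProtocol.joint]
  refine Finset.sum_congr rfl fun x _ => Finset.sum_congr rfl fun y _ =>
    Finset.sum_congr rfl fun ra _ => Finset.sum_congr rfl fun rb _ => by ring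

variable [Fintype X] [Fintype Y] [DecidableEq X] [DecidableEq Y]

/-- An expectation over uniform inputs from two points, restricted to one of them. -/
theorem ClassicalProtocol.sum_twoPoint (P : ClassicalProtocol X Y W) {i j : X × Y} (hij : i ≠ j)
    (q : X × Y → Prop) [DecidablePred q] (k : X × Y) (hk : ∀ l, l = i ∨ l = j → (q l ↔ l = k))
    (hkij : k = i ∨ k = j) (F : X × Y × Fin P.rA × Fin P.rB → ℝ) :
    ∑ ω, (if q (ω.1, ω.2.1) then F ω * P.joint (twoPoint i j hij) ω else 0) =
      1 / 2 * ∑ ra, ∑ rb, F (k.1, k.2, ra, rb) * (P.pA.1 ra * P.pB.1 rb) := by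
  have := P.sum_joint (twoPoint i j hij) fun ω => if q (ω.1, ω.2.1) then F ω else 0
  simp only [ite_mul, zero_mul] at this
  rw [this, ← Fintype.sum_prod_type' (f := fun x y => (twoPoint i j hij).1 (x, y) *
      ∑ ra, ∑ rb, if q (x, y) then F (x, y, ra, rb) * (P.pA.1 ra * P.pB.1 rb) else 0),
    Fintype.sum_eq_single k]
  · simp [twoPoint, hkij, (hk k hkij).2 rfl]
  · intro l hl
    by_cases hlij : l = i ∨ l = j
    · have : ¬ q l := fun h => hl ((hk l hlij).1 h)
      simp [this]
    · simp [twoPoint, hlij]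

/-- Zero information at time `q.length`, for a fair choice between two inputs with equal values of
`h`, makes the listener's view equally distributed; the test function is the indicator of the prefix
`q`. -/
theorem ClassicalProtocol.prefixWeight_eq_of_privacyLoss [DecidableEq W] (P : ClassicalProtocol X Y W)
    {h : X → Y → W} (hloss : P.privacyLoss h = 0) (q : List Bool) :
    (∀ x x' y, h x y = h x' y →
      P.tree.prefixWeight (fun _ => P.pA.1) (fun _ => P.pB.1) q x y =
        P.tree.prefixWeight (fun _ => P.pA.1) (fun _ => P.pB.1) q x' y) ∧
    ∀ y y' x, h x y = h x y' →
      P.tree.prefixWeight (fun _ => P.pA.1) (fun _ => P.pB.1) q x y =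
        P.tree.prefixWeight (fun _ => P.pA.1) (fun _ => P.pB.1) q x y' := by
  have hle := fun μ => iSup_le_iff.1 (iSup_le_iff.1 hloss.le q.length) μ
  have hp : ∀ μ ω, 0 ≤ P.joint μ ω := fun μ ω =>
    mul_nonneg (mul_nonneg (μ.2.1 _) (P.pA.2.1 _)) (P.pB.2.1 _)
  have hsupp : ∀ {i j : X × Y} (hij : i ≠ j) (ω), P.joint (twoPoint i j hij) ω ≠ 0 →
      (ω.1, ω.2.1) = i ∨ (ω.1, ω.2.1) = j := fun hij ω hω => by
    by_contra hn
    exact hω (by simp only [ClassicalProtocol.joint, twoPoint, if_neg hn, zero_mul])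
  constructor
  · intro x x' y hxx
    by_cases hne : x = x'
    · rw [hne]
    have hij : (x, y) ≠ (x', y) := by simpa using hne
    have hI : P.divulgedToBob h q.length (twoPoint _ _ hij) ≤ 0 := by
      exact_mod_cast (le_max_left _ _).trans (hle (twoPoint _ _ hij))
    have hsum : ∀ F : X × Y × Fin P.rA × Fin P.rB → ℝ, ∀ k, k = x ∨ k = x' →
        ∑ ω, (if ω.1 = k then F ω * P.joint (twoPoint _ _ hij) ω else 0) =
          1 / 2 * ∑ ra, ∑ rb, F (k, y, ra, rb) * (P.pA.1 ra * P.pB.1 rb) := fun F k hk =>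
      P.sum_twoPoint hij (fun l => l.1 = k) (k, y) (by rintro _ (rfl | rfl) <;> simp)
        (by simpa using hk) F
    have hone : ∀ k, k = x ∨ k = x' →
        ∑ ω, (if ω.1 = k then P.joint (twoPoint _ _ hij) ω else 0) = 1 / 2 := fun k hk => by
      have := hsum (fun _ => 1) k hk
      simpa only [one_mul, P.sum_coins, mul_one] using this
    have := sum_eq_of_condMutualInfo_nonpos (hp _) _ _ _ hne (z := (y, h x y)) (fun ω hω => by
      rcases hsupp hij ω hω with h1 | h1 <;> simp only [Prod.mk.injEq] at h1 <;>
        simp [h1.1, h1.2, hxx]) (hone x (Or.inl rfl)) (hone x' (Or.inr rfl)) hI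
      (fun v => if v.2 = q then 1 else 0)
    rw [hsum _ x (Or.inl rfl), hsum _ x' (Or.inr rfl)] at this
    simp only [ite_mul, one_mul, zero_mul] at this
    simpa [ProtocolTree.prefixWeight] using this
  · intro y y' x hyy
    by_cases hne : y = y'
    · rw [hne]
    have hij : (x, y) ≠ (x, y') := by simpa using hne
    have hI : P.divulgedToAl h q.length (twoPoint _ _ hij) ≤ 0 := by
      exact_mod_cast (le_max_right _ _).trans (hle (twoPoint _ _ hij))
    have hsum : ∀ F : X × Y × Fin P.rA × Fin P.rB → ℝ, ∀ k, k = y ∨ k = y' →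
        ∑ ω, (if ω.2.1 = k then F ω * P.joint (twoPoint _ _ hij) ω else 0) =
          1 / 2 * ∑ ra, ∑ rb, F (x, k, ra, rb) * (P.pA.1 ra * P.pB.1 rb) := fun F k hk =>
      P.sum_twoPoint hij (fun l => l.2 = k) (x, k) (by rintro _ (rfl | rfl) <;> simp)
        (by simpa using hk) F
    have hone : ∀ k, k = y ∨ k = y' →
        ∑ ω, (if ω.2.1 = k then P.joint (twoPoint _ _ hij) ω else 0) = 1 / 2 := fun k hk => by
      have := hsum (fun _ => 1) k hk
      simpa only [one_mul, P.sum_coins, mul_one] using this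
    have := sum_eq_of_condMutualInfo_nonpos (hp _) _ _ _ hne (z := (x, h x y)) (fun ω hω => by
      rcases hsupp hij ω hω with h1 | h1 <;> simp only [Prod.mk.injEq] at h1 <;>
        simp [h1.1, h1.2, hyy]) (hone y (Or.inl rfl)) (hone y' (Or.inr rfl)) hI
      (fun v => if v.2 = q then 1 else 0)
    rw [hsum _ y (Or.inl rfl), hsum _ y' (Or.inr rfl)] at this
    simp only [ite_mul, one_mul, zero_mul] at this
    simpa [ProtocolTree.prefixWeight] using this

end ClassicalLower

/-! ### Classical protocols compute only functions without forbidden rectangles. -/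

section ClassicalLower

variable {X Y W : Type*}

/-- A vanishing `α` forces `a' = 0`, so no division by a possibly zero weight is needed. -/
theorem mul_eq_mul_of_le {α a' β β' : ℝ} (h0 : 0 ≤ a') (hle : a' ≤ α) (h : α * β = α * β') :
    a' * β = a' * β' := by
  rcases mul_eq_mul_left_iff.1 h with h | h
  · rw [h]
  · rw [le_antisymm (hle.trans h.le) h0, zero_mul, zero_mul]

/-- If the product weight `α x * β y` is constant on `S × T`, and `α' ≤ α` is such that
`α' x * β y` is determined by `(y, h x y)`, then `α' x * β y` is also constant on `S × T`. -/
theorem RowConnected.mul_eq_mul {h : X → Y → W} {S : Set X} {T : Set Y} (hS : RowConnected h S T)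
    {α α' : X → ℝ} {β : Y → ℝ} (hα0 : ∀ x, 0 ≤ α' x) (hα : ∀ x, α' x ≤ α x)
    (hinv : ∀ x ∈ S, ∀ y ∈ T, ∀ x' ∈ S, ∀ y' ∈ T, α x * β y = α x' * β y')
    (hpriv : ∀ x x' y, h x y = h x' y → α' x * β y = α' x' * β y) :
    ∀ x ∈ S, ∀ y ∈ T, ∀ x' ∈ S, ∀ y' ∈ T, α' x * β y = α' x' * β y' := by
  have hcol : ∀ x ∈ S, ∀ y ∈ T, ∀ y' ∈ T, α' x * β y = α' x * β y' := fun x hx y hy y' hy' =>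
    mul_eq_mul_of_le (hα0 x) (hα x) (hinv x hx y hy x hx y' hy')
  have hrow := hS.rel (fun x (y : T) => α' x * β y) fun x hx x' hx' y₀ hy₀ hxx => by
    funext y
    rw [hcol x hx y y.2 y₀ hy₀, hcol x' hx' y y.2 y₀ hy₀, hpriv x x' y₀ hxx]
  intro x hx y hy x' hx' y' hy'
  rw [hcol x hx y hy y' hy']
  exact congrFun (hrow x hx x' hx') ⟨y', hy'⟩

variable {RA RB : Type} [Fintype RA] [Fintype RB]

theorem ProtocolTree.prefixWeight_nil (t : ProtocolTree X Y W RA RB) (a : X → RA → ℝ)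
    (b : Y → RB → ℝ) (x : X) (y : Y) :
    t.prefixWeight a b [] x y = (∑ ra, a x ra) * ∑ rb, b y rb := by
  simp [ProtocolTree.prefixWeight, Finset.sum_mul_sum]

/-- Conditioning on a bit of Al is absorbed into his coin weights. Allowing unnormalized weights
that depend on the input keeps the subtree in product form. -/
theorem ProtocolTree.prefixWeight_al (bit : X → RA → Bool)
    (next : Bool → ProtocolTree X Y W RA RB) (a : X → RA → ℝ) (b : Y → RB → ℝ) (c : Bool)
    (q : List Bool) (x : X) (y : Y) :
    (ProtocolTree.al bit next).prefixWeight a b (c :: q) x y =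
      (next c).prefixWeight (fun x ra => if bit x ra = c then a x ra else 0) b q x y := by
  refine Finset.sum_congr rfl fun ra _ => Finset.sum_congr rfl fun rb _ => ?_
  by_cases hc : bit x ra = c
  · simp [ProtocolTree.transcript, hc]
  · simp [ProtocolTree.transcript, hc]

theorem ProtocolTree.prefixWeight_bob (bit : Y → RB → Bool)
    (next : Bool → ProtocolTree X Y W RA RB) (a : X → RA → ℝ) (b : Y → RB → ℝ) (c : Bool)
    (q : List Bool) (x : X) (y : Y) :
    (ProtocolTree.bob bit next).prefixWeight a b (c :: q) x y =
      (next c).prefixWeight a (fun y rb => if bit y rb = c then b y rb else 0) q x y := by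
  refine Finset.sum_congr rfl fun ra _ => Finset.sum_congr rfl fun rb _ => ?_
  by_cases hc : bit y rb = c
  · simp [ProtocolTree.transcript, hc]
  · simp [ProtocolTree.transcript, hc]

theorem ProtocolTree.outputMean_al (bit : X → RA → Bool)
    (next : Bool → ProtocolTree X Y W RA RB) (a : X → RA → ℝ) (b : Y → RB → ℝ) (F : W × W → ℝ)
    (x : X) (y : Y) :
    (ProtocolTree.al bit next).outputMean a b F x y = ∑ c,
      (next c).outputMean (fun x ra => if bit x ra = c then a x ra else 0) b F x y := by
  simp only [ProtocolTree.outputMean, Fintype.sum_bool, ← Finset.sum_add_distrib]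
  refine Finset.sum_congr rfl fun ra _ => Finset.sum_congr rfl fun rb _ => ?_
  cases hc : bit x ra <;> simp [ProtocolTree.outputs, hc]

theorem ProtocolTree.outputMean_bob (bit : Y → RB → Bool)
    (next : Bool → ProtocolTree X Y W RA RB) (a : X → RA → ℝ) (b : Y → RB → ℝ) (F : W × W → ℝ)
    (x : X) (y : Y) :
    (ProtocolTree.bob bit next).outputMean a b F x y = ∑ c,
      (next c).outputMean a (fun y rb => if bit y rb = c then b y rb else 0) F x y := by
  simp only [ProtocolTree.outputMean, Fintype.sum_bool, ← Finset.sum_add_distrib]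
  refine Finset.sum_congr rfl fun ra _ => Finset.sum_congr rfl fun rb _ => ?_
  cases hc : bit y rb <;> simp [ProtocolTree.outputs, hc]

/-- On a forbidden rectangle, the output distribution of Al does not depend on the input of Bob,
and vice versa. -/
theorem ProtocolTree.outputMean_eq {h : X → Y → W} {S : Set X} {T : Set Y}
    (hS : RowConnected h S T) (hT : RowConnected (fun y x => h x y) T S)
    (t : ProtocolTree X Y W RA RB) {a : X → RA → ℝ} {b : Y → RB → ℝ} (ha : ∀ x ra, 0 ≤ a x ra)
    (hb : ∀ y rb, 0 ≤ b y rb)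
    (hinv : ∀ x ∈ S, ∀ y ∈ T, ∀ x' ∈ S, ∀ y' ∈ T,
      (∑ ra, a x ra) * ∑ rb, b y rb = (∑ ra, a x' ra) * ∑ rb, b y' rb)
    (hB : ∀ q x x' y, h x y = h x' y → t.prefixWeight a b q x y = t.prefixWeight a b q x' y)
    (hA : ∀ q y y' x, h x y = h x y' → t.prefixWeight a b q x y = t.prefixWeight a b q x y')
    (G : W → ℝ) :
    (∀ x ∈ S, ∀ y ∈ T, ∀ y' ∈ T, t.outputMean a b (fun w => G w.1) x y =
      t.outputMean a b (fun w => G w.1) x y') ∧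
    ∀ x ∈ S, ∀ x' ∈ S, ∀ y ∈ T, t.outputMean a b (fun w => G w.2) x y =
      t.outputMean a b (fun w => G w.2) x' y := by
  induction t generalizing a b with
  | output outA outB =>
    have mean_fst : ∀ x y, (ProtocolTree.output outA outB).outputMean a b (fun w => G w.1) x y =
        ∑ ra, G (outA x ra) * (a x ra * ∑ rb, b y rb) := fun x y => by
      simp only [ProtocolTree.outputMean, ProtocolTree.outputs, Finset.mul_sum]
    have mean_snd : ∀ x y, (ProtocolTree.output outA outB).outputMean a b (fun w => G w.2) x y =
        ∑ rb, G (outB y rb) * (b y rb * ∑ ra, a x ra) := fun x y => by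
      simp only [ProtocolTree.outputMean, ProtocolTree.outputs, Finset.mul_sum]
      rw [Finset.sum_comm]
      simp only [mul_comm (b _ _)]
    constructor
    · intro x hx y hy y' hy'
      rw [mean_fst, mean_fst]
      refine Finset.sum_congr rfl fun ra _ => ?_
      rw [mul_eq_mul_of_le (ha x ra)
        -- A single coin's weight is at most the total, so constancy of the total product passes to
        -- it.
        (Finset.single_le_sum (fun r _ => ha x r) (Finset.mem_univ ra)) (hinv x hx y hy x hx y' hy')]
    · intro x hx x' hx' y hy
      have hinv' : (∑ rb, b y rb) * ∑ ra, a x ra = (∑ rb, b y rb) * ∑ ra, a x' ra := by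
        rw [mul_comm, hinv x hx y hy x' hx' y hy, mul_comm]
      rw [mean_snd, mean_snd]
      refine Finset.sum_congr rfl fun rb _ => ?_
      rw [mul_eq_mul_of_le (hb y rb)
        (Finset.single_le_sum (fun r _ => hb y r) (Finset.mem_univ rb)) hinv']
  | al bit next ih =>
    simp only [ProtocolTree.outputMean_al]
    have key := fun c => ih c (a := fun x ra => if bit x ra = c then a x ra else 0) (b := b)
      (fun x ra => by split_ifs; exacts [ha x ra, le_rfl]) hb
      (hS.mul_eq_mul (α := fun x => ∑ ra, a x ra)
        (fun x => Finset.sum_nonneg fun ra _ => by split_ifs; exacts [ha x ra, le_rfl])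
        (fun x => Finset.sum_le_sum fun ra _ => by split_ifs; exacts [le_rfl, ha x ra])
        hinv
        (fun x x' y hxx => by
          -- The one-bit prefix supplies the privacy of the weight that survives Al's bit `c`.
          have := hB [c] x x' y hxx
          rwa [ProtocolTree.prefixWeight_al, ProtocolTree.prefixWeight_al,
            ProtocolTree.prefixWeight_nil, ProtocolTree.prefixWeight_nil] at this))
      (fun q x x' y hxx => by
        simpa only [ProtocolTree.prefixWeight_al] using hB (c :: q) x x' y hxx)
      (fun q y y' x hyy => by
        simpa only [ProtocolTree.prefixWeight_al] using hA (c :: q) y y' x hyy)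
    exact ⟨fun x hx y hy y' hy' => Finset.sum_congr rfl fun c _ => (key c).1 x hx y hy y' hy',
      fun x hx x' hx' y hy => Finset.sum_congr rfl fun c _ => (key c).2 x hx x' hx' y hy⟩
  | bob bit next ih =>
    simp only [ProtocolTree.outputMean_bob]
    have key := fun c => ih c (a := a) (b := fun y rb => if bit y rb = c then b y rb else 0) ha
      (fun y rb => by split_ifs; exacts [hb y rb, le_rfl])
      (fun x hx y hy x' hx' y' hy' => by
        have := hT.mul_eq_mul (α := fun y => ∑ rb, b y rb)
          (α' := fun y => ∑ rb, if bit y rb = c then b y rb else 0) (β := fun x => ∑ ra, a x ra)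
          (fun y => Finset.sum_nonneg fun rb _ => by split_ifs; exacts [hb y rb, le_rfl])
          (fun y => Finset.sum_le_sum fun rb _ => by split_ifs; exacts [le_rfl, hb y rb])
          (fun y hy x hx y' hy' x' hx' => by
            rw [mul_comm, hinv x hx y hy x' hx' y' hy', mul_comm])
          (fun y y' x hyy => by
            have := hA [c] y y' x hyy
            rw [ProtocolTree.prefixWeight_bob, ProtocolTree.prefixWeight_bob,
              ProtocolTree.prefixWeight_nil, ProtocolTree.prefixWeight_nil] at this
            rw [mul_comm, this, mul_comm]) y hy x hx y' hy' x' hx'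
        rw [mul_comm, this, mul_comm])
      (fun q x x' y hxx => by
        simpa only [ProtocolTree.prefixWeight_bob] using hB (c :: q) x x' y hxx)
      (fun q y y' x hyy => by
        simpa only [ProtocolTree.prefixWeight_bob] using hA (c :: q) y y' x hyy)
    exact ⟨fun x hx y hy y' hy' => Finset.sum_congr rfl fun c _ => (key c).1 x hx y hy y' hy',
      fun x hx x' hx' y hy => Finset.sum_congr rfl fun c _ => (key c).2 x hx x' hx' y hy⟩

theorem ClassicalProtocol.noForbidden [Fintype X] [Fintype Y] [DecidableEq X] [DecidableEq Y]
    [DecidableEq W] {ε : ℝ} (hε : ε < 1 / 2) (P : ClassicalProtocol X Y W)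
    {h : X → Y → W} (hP : P.Computes ε h) (hloss : P.privacyLoss h = 0) : NoForbidden h := by
  intro S T hS hT
  have key := fun G => P.tree.outputMean_eq hS hT (a := fun _ => P.pA.1) (b := fun _ => P.pB.1)
    (fun _ => P.pA.2.1) (fun _ => P.pB.2.1) (fun _ _ _ _ _ _ _ _ => rfl)
    (fun q => (P.prefixWeight_eq_of_privacyLoss hloss q).1)
    (fun q => (P.prefixWeight_eq_of_privacyLoss hloss q).2) G
  have hpos : ∀ r : Fin P.rA × Fin P.rB, 0 ≤ P.pA.1 r.1 * P.pB.1 r.2 := fun r =>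
    mul_nonneg (P.pA.2.1 _) (P.pB.2.1 _)
  have hsum : ∑ r : Fin P.rA × Fin P.rB, P.pA.1 r.1 * P.pB.1 r.2 = 1 := by
    rw [Fintype.sum_prod_type]
    exact P.sum_coins
  have mean : ∀ (F : W × W → W) (w x y), P.tree.outputMean (fun _ => P.pA.1) (fun _ => P.pB.1)
      (fun v => if F v = w then 1 else 0) x y = ∑ r : Fin P.rA × Fin P.rB,
        if F (P.tree.outputs x y r.1 r.2) = w then P.pA.1 r.1 * P.pB.1 r.2 else 0 :=
    fun F w x y => by
      rw [Fintype.sum_prod_type]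
      simp only [ProtocolTree.outputMean, ite_mul, one_mul, zero_mul]
  -- `F` stands for either projection: joint success bounds each player's own success from below.
  have hlarge : ∀ (F : W × W → W), (∀ w, F (w, w) = w) → ∀ x y, 1 / 2 < ∑ r : Fin P.rA × Fin P.rB,
      if F (P.tree.outputs x y r.1 r.2) = h x y then P.pA.1 r.1 * P.pB.1 r.2 else 0 :=
    fun F hF x y => by
      have h1 := hP x y
      rw [← Fintype.sum_prod_type' (f := fun ra rb =>
        if P.tree.outputs x y ra rb = (h x y, h x y) then P.pA.1 ra * P.pB.1 rb else 0)] at h1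
      refine lt_of_lt_of_le (by linarith) (h1.trans (Finset.sum_le_sum fun r _ => ?_))
      by_cases ho : P.tree.outputs x y r.1 r.2 = (h x y, h x y)
      · simp [ho, hF]
      · rw [if_neg ho]
        split_ifs
        exacts [hpos r, le_rfl]
  intro x hx y hy x' hx' y' hy'
  have h1 : h x y = h x y' := by
    refine eq_of_half_lt hpos hsum (fun r => (P.tree.outputs x y r.1 r.2).1)
      (hlarge Prod.fst (fun _ => rfl) x y) ?_
    rw [← mean Prod.fst, (key fun v => if v = h x y' then 1 else 0).1 x hx y hy y' hy',
      mean Prod.fst]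
    exact hlarge Prod.fst (fun _ => rfl) x y'
  have h2 : h x y' = h x' y' := by
    refine eq_of_half_lt hpos hsum (fun r => (P.tree.outputs x y' r.1 r.2).2)
      (hlarge Prod.snd (fun _ => rfl) x y') ?_
    rw [← mean Prod.snd, (key fun v => if v = h x' y' then 1 else 0).2 x hx x' hx' y' hy',
      mean Prod.snd]
    exact hlarge Prod.snd (fun _ => rfl) x' y'
  exact h1.trans h2

end ClassicalLower

/-! ### The common characterization and the hint-sense loss. -/

section Hint

variable {X Y : Type*} [Fintype X] [Fintype Y] [DecidableEq X] [DecidableEq Y]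
  [Nonempty X] [Nonempty Y]

theorem classicallyPrivate_iff {V : Type} [DecidableEq V] {h : X → Y → V} {ε : ℝ}
    (hε : 0 ≤ ε) (hε' : ε < 1 / 2) : ClassicallyPrivate ε h ↔ NoForbidden h := by
  have : Nonempty V := ⟨h (Classical.arbitrary X) (Classical.arbitrary Y)⟩
  constructor
  · rintro ⟨P, hP, hloss⟩
    exact P.noForbidden hε' hP hloss
  · intro hh
    obtain ⟨n, hn⟩ := hh.exists_decomposable Set.univ Set.univ
    obtain ⟨P, -, hP, hloss⟩ := hn.deterministicallyPrivate
    exact ⟨P, fun x y => (by linarith : 1 - ε ≤ 1 - 0).trans (hP x y), hloss⟩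

theorem deterministicallyPrivate_iff {V : Type} [DecidableEq V] {h : X → Y → V} :
    DeterministicallyPrivate h ↔ NoForbidden h := by
  have : Nonempty V := ⟨h (Classical.arbitrary X) (Classical.arbitrary Y)⟩
  constructor
  · rintro ⟨P, -, hP, hloss⟩
    exact P.noForbidden (by norm_num) hP hloss
  · intro hh
    obtain ⟨n, hn⟩ := hh.exists_decomposable Set.univ Set.univ
    exact hn.deterministicallyPrivate

theorem quantumPrivate_iff {V : Type} [Fintype V] [DecidableEq V] {h : X → Y → V} {ε : ℝ}
    (hε : 0 ≤ ε) (hε' : ε < 1 / 2) : QuantumPrivate ε h ↔ NoForbidden h := by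
  have : Nonempty V := ⟨h (Classical.arbitrary X) (Classical.arbitrary Y)⟩
  constructor
  · rintro ⟨P, hP, hloss⟩
    exact P.noForbidden hε' hP hloss
  · intro hh
    obtain ⟨n, hn⟩ := hh.exists_decomposable Set.univ Set.univ
    exact hn.quantumPrivate hε

theorem HintComputable.congr {X Y Z : Type*}
    {Priv Priv' : ∀ (W : Type) [Fintype W] [DecidableEq W], (X → Y → W) → Prop}
    (hPriv : ∀ (W : Type) [Fintype W] [DecidableEq W] (h : X → Y → W), Priv W h ↔ Priv' W h)
    (f : X → Y → Z) (k : ℝ) : HintComputable Priv f k ↔ HintComputable Priv' f k := by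
  simp only [HintComputable, hPriv]

/-- The range of `f` is the image under `g` of the range of `h`, hence no larger. -/
theorem HintComputable.nonneg {X Y Z : Type*} [Finite X] [Finite Y] [Nonempty X] [Nonempty Y]
    {Priv : ∀ (W : Type) [Fintype W] [DecidableEq W], (X → Y → W) → Prop}
    {f : X → Y → Z} {k : ℝ} (hk : HintComputable Priv f k) : 0 ≤ k := by
  obtain ⟨W, _, _, h, -, ⟨g, hg⟩, rfl⟩ := hk
  have hsub : (Set.range fun p : X × Y => f p.1 p.2) =
      g '' Set.range fun p : X × Y => h p.1 p.2 := by
    rw [← Set.range_comp]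
    exact congrArg Set.range (funext fun p => hg p.1 p.2)
  have hpos : 0 < (Set.range fun p : X × Y => f p.1 p.2).ncard :=
    (Set.ncard_pos (Set.finite_range _)).2 (Set.range_nonempty _)
  have hle : (Set.range fun p : X × Y => f p.1 p.2).ncard ≤
      (Set.range fun p : X × Y => h p.1 p.2).ncard := by
    rw [hsub]
    exact Set.ncard_image_le (Set.finite_range _)
  exact sub_nonneg.2 (Real.logb_le_logb_of_le (by norm_num) (by exact_mod_cast hpos)
    (by exact_mod_cast hle))

/-- Announcing both inputs divulges nothing beyond the value of the function. -/
theorem noForbidden_of_injective {X Y V : Type*} {h : X → Y → V}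
    (hh : ∀ x y x' y', h x y = h x' y' → x = x' ∧ y = y') : NoForbidden h := by
  intro S T hS hT x hx y hy x' hx' y' hy'
  have hxx : x = x' := hS.rel id (fun x _ x' _ y _ h => (hh x y x' y h).1) x hx x' hx'
  have hyy : y = y' := hT.rel id (fun y _ y' _ x _ h => (hh x y x y' h).2) y hy y' hy'
  rw [hxx, hyy]

theorem exists_hintComputable {Z : Type*} (f : X → Y → Z) :
    ∃ k, HintComputable (fun _ _ _ h => DeterministicallyPrivate h) f k := by
  refine ⟨_, Fin (Fintype.card X) × Fin (Fintype.card Y), inferInstance, inferInstance,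
    fun x y => (Fintype.equivFin X x, Fintype.equivFin Y y),
    deterministicallyPrivate_iff.2 (noForbidden_of_injective (by simp)),
    ⟨fun w => f ((Fintype.equivFin X).symm w.1) ((Fintype.equivFin Y).symm w.2), by simp⟩, rfl⟩

/-- A member rules out `⊤` and a lower bound rules out `⊥`. -/
theorem exists_iInf_ereal_eq_coe {p : ℝ → Prop} {b : ℝ} (hne : ∃ k, p k) (hb : ∀ k, p k → b ≤ k) :
    ∃ k : ℝ, ⨅ (k : ℝ) (_ : p k), (k : EReal) = k := by
  obtain ⟨k₀, hk₀⟩ := hne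
  have h1 : ((b : ℝ) : EReal) ≤ ⨅ (k : ℝ) (_ : p k), (k : EReal) :=
    le_iInf₂ fun k hk => EReal.coe_le_coe_iff.2 (hb k hk)
  have h2 : ⨅ (k : ℝ) (_ : p k), (k : EReal) ≤ (k₀ : EReal) := iInf₂_le k₀ hk₀
  exact ⟨_, (EReal.coe_toReal (ne_top_of_le_ne_top (EReal.coe_ne_top k₀) h2)
    (ne_bot_of_le_ne_bot (EReal.coe_ne_bot b) h1)).symm⟩

end Hint

end TwoParty

end

theorem mainTheorem12 {X Y Z : Type*} [Fintype X] [Fintype Y] [DecidableEq X] [DecidableEq Y]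
    [Nonempty X] [Nonempty Y] (f : X → Y → Z) (ε₁ ε₂ : ℝ)
    (hε₁ : 0 ≤ ε₁) (hε₁' : ε₁ < 1 / 2) (hε₂ : 0 ≤ ε₂) (hε₂' : ε₂ < 1 / 2) :
    (∀ k : ℝ,
      (TwoParty.HintComputable (fun _ _ _ h => TwoParty.ClassicallyPrivate ε₁ h) f k ↔
        TwoParty.HintComputable (fun _ _ _ h => TwoParty.DeterministicallyPrivate h) f k) ∧
      (TwoParty.HintComputable (fun _ _ _ h => TwoParty.QuantumPrivate ε₂ h) f k ↔
        TwoParty.HintComputable (fun _ _ _ h => TwoParty.ClassicallyPrivate ε₁ h) f k)) ∧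
    ∃ k : ℝ, TwoParty.deterministicHintLoss f = k ∧ TwoParty.classicalHintLoss ε₁ f = k ∧
      TwoParty.quantumHintLoss ε₂ f = k := by
  have hCD : ∀ k : ℝ,
      TwoParty.HintComputable (fun _ _ _ h => TwoParty.ClassicallyPrivate ε₁ h) f k ↔
        TwoParty.HintComputable (fun _ _ _ h => TwoParty.DeterministicallyPrivate h) f k :=
    TwoParty.HintComputable.congr (fun _ _ _ _ =>
      (TwoParty.classicallyPrivate_iff hε₁ hε₁').trans
        TwoParty.deterministicallyPrivate_iff.symm) f
  have hQC : ∀ k : ℝ,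
      TwoParty.HintComputable (fun _ _ _ h => TwoParty.QuantumPrivate ε₂ h) f k ↔
        TwoParty.HintComputable (fun _ _ _ h => TwoParty.ClassicallyPrivate ε₁ h) f k :=
    TwoParty.HintComputable.congr (fun _ _ _ _ =>
      (TwoParty.quantumPrivate_iff hε₂ hε₂').trans
        (TwoParty.classicallyPrivate_iff hε₁ hε₁').symm) f
  obtain ⟨k, hk⟩ := TwoParty.exists_iInf_ereal_eq_coe (TwoParty.exists_hintComputable f)
    fun _ => TwoParty.HintComputable.nonneg
  refine ⟨fun k => ⟨hCD k, hQC k⟩, k, hk, ?_, ?_⟩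
  · rw [← hk]
    simp only [TwoParty.classicalHintLoss, TwoParty.hintPrivacyLoss, hCD]
  · rw [← hk]
    simp only [TwoParty.quantumHintLoss, TwoParty.hintPrivacyLoss, hQC, hCD]
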